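/- **Conventions.** Let $\ell$ be a prime and fix a ring homomorphism $*$ from the ring of algebraic integers in $\mathbb C$ to $\overline{\mathbb F}_\ell$; it extends to all fractions $a/b$ of algebraic integers with $b^*\neq 0$. For a finite group $X$ let $\mathrm{Irr}(X)$ be the set of its complex irreducible characters. For $\chi\in\mathrm{Irr}(X)$, a conjugacy class $\mathcal K$ of $X$ and $x\in\mathcal K$ put $\lambda_\chi(\mathcal K^+)=\big(|\mathcal K|\chi(x)/\chi(1)\big)^*$. Two characters $\chi,\psi\in\mathrm{Irr}(X)$ lie in the same ($\ell$-)block if $\lambda_\chi=\lambda_\psi$; for a block $B$ write $\lambda_B$ for the common function, extended additively to unions of classes. For $Y\le X$ and a block $b$ of $Y$, "$b^X=B$" means that $B$ is the block of $X$ with $\lambda_B(\mathcal K^+)=\lambda_b((\mathcal K\cap Y)^+)$ for every conjugacy class $\mathcal K$ of $X$. A defect group of $B$ is a Sylow $\ell$-subgroup of $C_X(x)$, where $x$ lies in a class on which neither $\lambda_B$ nor the coefficient $\big(|X|^{-1}\sum_{\psi\in \mathrm{Irr}(B)}\psi(1)\psi(x^{-1})\big)^*$ of the block idempotent vanishes.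 For an $\ell$-subgroup $D\le X$, $\mathrm{Irr}_0(X|D)$ is the set of those $\chi\in\mathrm{Irr}(X)$ that lie in a block with defect group $D$ and have height zero, i.e. $\chi(1)_\ell=|X|_\ell/|D|$. For $Y\le X$ and $\nu\in\mathrm{Irr}(Y)$, $\mathrm{Irr}(X|\nu)$ is the set of irreducible characters of $X$ whose restriction to $Y$ has $\nu$ as a constituent. **Lemma 5.6.** Let $S$ be a finite simple group with universal $\ell'$-covering group $G$ (the universal perfect central extension of $S$ with kernel of order prime to $\ell$), and let $Q$ be an $\ell$-radical subgroup of $G$, i.e. an $\ell$-subgroup with $Q=\mathbf O_\ell(N_G(Q))$. Suppose that $Q$ satisfies conditions (i) and (ii) of Späth's inductive Alperin–McKay condition with $M_Q=N_G(Q)$; that is, there is given a bijection $$\Omega_Q\colon \mathrm{Irr}_0(G|Q)\to\mathrm{Irr}_0(N_G(Q)|Q)$$ which commutes with the action of the stabilizer $\mathrm{Aut}(G)_Q$ of $Q$ in $\mathrm{Aut}(G)$, maps $\mathrm{Irr}_0(G|Q)\cap\mathrm{Irr}(G|\nu)$ into $\mathrm{Irr}(N_G(Q)|\nu)$ for every $\nu\in\mathrm{Irr}(Z(G))$,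 and is such that $b^G=B$ whenever $\chi\in\mathrm{Irr}_0(G|Q)$ lies in the block $B$ of $G$ and $\Omega_Q(\chi)$ lies in the block $b$ of $N_G(Q)$. (The requirement $M_Q\neq G$ in condition (i) is not needed.) Let $\chi\in\mathrm{Irr}_0(G|Q)$ be such that $\mathrm{Aut}(S)_\chi/S$ is cyclic, where $\mathrm{Aut}(S)_\chi$ is the group of automorphisms of $S$ whose lift to $G$ fixes $\chi$ and $S$ is identified with the group of inner automorphisms of $S$. Let $\eta\in\mathrm{Aut}(G)_\chi$ with $\mathrm{Aut}(S)_\chi=\langle S,\eta\rangle$, where $\eta$ also denotes the automorphism of $S$ that it induces. Put $A(\chi)=G\rtimes\langle\eta\rangle$, and let $G\le A_{\ell'}\le A(\chi)$ be such that $A_{\ell'}/G$ is the Hall $\ell'$-subgroup of the cyclic group $A(\chi)/G$. Then there are $\tilde\chi\in\mathrm{Irr}(A(\chi))$ and $\widetilde{\Omega_Q(\chi)}\in\mathrm{Irr}(N_{A(\chi)}(Q))$ such that: 1. $\tilde\chi|_G=\chi$; 2. $\widetilde{\Omega_Q(\chi)}|_{N_G(Q)}=\Omega_Q(\chi)$;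 3. $\tilde b^{A_{\ell'}}=\tilde B$, where $\tilde b$ is the block of $N_{A_{\ell'}}(Q)$ containing $\widetilde{\Omega_Q(\chi)}|_{N_{A_{\ell'}}(Q)}$ and $\tilde B$ is the block of $A_{\ell'}$ containing $\tilde\chi|_{A_{\ell'}}$ (in particular both restrictions are irreducible). -/

import Mathlib

noncomputable section

namespace BlockTheory

/-! ### Ordinary irreducible characters -/

/-- `χ` is the character of an irreducible finite-dimensional complex representation of `G`. -/
def IsIrredChar {G : Type*} [Group G] (χ : G → ℂ) : Prop :=
  ∃ (n : ℕ) (ρ : Representation ℂ G (Fin n → ℂ)), ρ.IsIrreducible ∧ ρ.character = χ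

/-- `Irr(G)`, the set of complex irreducible characters of `G`. -/
def Irr (G : Type*) [Group G] : Type _ := {χ : G → ℂ // IsIrredChar χ}

instance instCoeFunIrr {G : Type*} [Group G] : CoeFun (Irr G) (fun _ => G → ℂ) := ⟨fun χ => χ.1⟩

/-- For a homomorphism `f : H → G` of finite groups (in practice an inclusion) and `ν ∈ Irr(H)`,
`χ ∈ Irr(G)`: the inner product of the restriction of `χ` with `ν` is not zero, that is,
`ν` is a constituent of the restriction of `χ`; equivalently `χ ∈ Irr(G | ν)`. -/
def LiesOver {H G : Type*} [Group H] [Group G] (f : H →* G) (χ : Irr G) (ν : Irr H) : Prop :=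
  ∑ᶠ h : H, χ (f h) * (starRingEnd ℂ) (ν h) ≠ 0

/-! ### Reduction modulo `ℓ` and blocks

`red` is a ring homomorphism from the ring of all algebraic integers in `ℂ` to an algebraic
closure of the field with `ℓ` elements. -/

/-- The extension of `red` to the ring of local integers, that is, the fractions `a / b` of
algebraic integers with `red b ≠ 0`; the value is `0` off this ring. -/
def localRed {ℓ : ℕ} [Fact ℓ.Prime] (red : integralClosure ℤ ℂ →+* AlgebraicClosure (ZMod ℓ))
    (z : ℂ) : AlgebraicClosure (ZMod ℓ) :=
  open Classical in
  if h : ∃ p : integralClosure ℤ ℂ × integralClosure ℤ ℂ,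
      red p.2 ≠ 0 ∧ z * (p.2 : ℂ) = (p.1 : ℂ) then
    red h.choose.1 / red h.choose.2
  else 0

/-- `localRed` does not depend on the fraction that represents its argument. -/
theorem localRed_eq {ℓ : ℕ} [Fact ℓ.Prime]
    (red : integralClosure ℤ ℂ →+* AlgebraicClosure (ZMod ℓ)) (z : ℂ)
    (a b : integralClosure ℤ ℂ) (hb : red b ≠ 0) (hz : z * (b : ℂ) = (a : ℂ)) :
    localRed red z = red a / red b := by
  have h : ∃ p : integralClosure ℤ ℂ × integralClosure ℤ ℂ,
      red p.2 ≠ 0 ∧ z * (p.2 : ℂ) = (p.1 : ℂ) := ⟨(a, b), hb, hz⟩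
  unfold localRed
  rw [dif_pos h]
  obtain ⟨h1, h2⟩ := h.choose_spec
  rw [div_eq_div_iff h1 hb, ← map_mul, ← map_mul]
  congr 1
  apply Subtype.ext
  push_cast
  rw [← h2, ← hz]
  ring

/-- The central character of `χ` on the sum of a conjugacy class `K`:
`ω_χ(K⁺) = |K| χ(x) / χ(1)` for `x ∈ K`. -/
def centralChar {G : Type*} [Group G] (χ : Irr G) (K : ConjClasses G) : ℂ :=
  (Nat.card K.carrier : ℂ) * χ K.exists_rep.choose / χ 1

/-- `λ_χ`, the reduction of the central character of `χ` (which has algebraic integers as its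
values on class sums), as a function on conjugacy classes. -/
def lam {ℓ : ℕ} [Fact ℓ.Prime] (red : integralClosure ℤ ℂ →+* AlgebraicClosure (ZMod ℓ))
    {G : Type*} [Group G] (χ : Irr G) : ConjClasses G → AlgebraicClosure (ZMod ℓ) :=
  fun K => localRed red (centralChar χ K)

/-- The set of `ℓ`-blocks of `G`: `χ` and `ψ` lie in the same block if and only if
`λ_χ = λ_ψ`. -/
def Block {ℓ : ℕ} [Fact ℓ.Prime] (red : integralClosure ℤ ℂ →+* AlgebraicClosure (ZMod ℓ))
    (G : Type*) [Group G] : Type _ :=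
  Quotient (Setoid.ker (lam red : Irr G → _))

/-- `Bl(G | χ)`, the block of `G` that contains `χ`. -/
def bl {ℓ : ℕ} [Fact ℓ.Prime] (red : integralClosure ℤ ℂ →+* AlgebraicClosure (ZMod ℓ))
    {G : Type*} [Group G] (χ : Irr G) : Block red G :=
  Quotient.mk (Setoid.ker (lam red : Irr G → _)) χ

/-- `λ_B`, which is `λ_χ` for every `χ` in `B`, as a function on conjugacy classes. -/
def Block.lam {ℓ : ℕ} [Fact ℓ.Prime] {red : integralClosure ℤ ℂ →+* AlgebraicClosure (ZMod ℓ)}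
    {G : Type*} [Group G] (B : Block red G) : ConjClasses G → AlgebraicClosure (ZMod ℓ) :=
  Setoid.kerLift (BlockTheory.lam red : Irr G → _) B

/-- For an injective homomorphism `f : H → G` (an inclusion): `b^G` is defined and equal to `B`,
that is, `λ_B(K⁺) = λ_b((K ∩ H)⁺)` for every conjugacy class `K` of `G`. The set `K ∩ H` is the
disjoint union of the classes of `H` that `f` maps into `K`. There is at most one such `B`, as
blocks are determined by the function `λ_B`. -/
def IsInducedBlock {ℓ : ℕ} [Fact ℓ.Prime]
    {red : integralClosure ℤ ℂ →+* AlgebraicClosure (ZMod ℓ)}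
    {H G : Type*} [Group H] [Group G] (f : H →* G) (b : Block red H) (B : Block red G) : Prop :=
  ∀ K : ConjClasses G, B.lam K = ∑ᶠ L : {L : ConjClasses H // ConjClasses.map f L = K}, b.lam L.1

/-- The coefficient at `x` of the block idempotent
`e_B = ∑_{ψ ∈ B} (ψ(1) / |G|) ∑_x ψ(x⁻¹) x`, reduced modulo `ℓ`. -/
def Block.idempotentCoeff {ℓ : ℕ} [Fact ℓ.Prime]
    {red : integralClosure ℤ ℂ →+* AlgebraicClosure (ZMod ℓ)}
    {G : Type*} [Group G] (B : Block red G) (x : G) : AlgebraicClosure (ZMod ℓ) :=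
  localRed red ((Nat.card G : ℂ)⁻¹ * ∑ᶠ ψ : {ψ : Irr G // bl red ψ = B}, ψ.1 1 * ψ.1 x⁻¹)

/-- `D` is a defect group of `B`: it is a Sylow `ℓ`-subgroup of the centralizer of an element `x`
of a defect class of `B`, a class on which neither `λ_B` nor the block idempotent vanishes. -/
def Block.IsDefectGroup {ℓ : ℕ} [Fact ℓ.Prime]
    {red : integralClosure ℤ ℂ →+* AlgebraicClosure (ZMod ℓ)}
    {G : Type*} [Group G] (B : Block red G) (D : Subgroup G) : Prop :=
  ∃ x : G, B.lam (ConjClasses.mk x) ≠ 0 ∧ B.idempotentCoeff x ≠ 0 ∧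
    ∃ P : Sylow ℓ (Subgroup.centralizer {x}),
      (P : Subgroup (Subgroup.centralizer {x})).map (Subgroup.centralizer {x}).subtype = D

/-- `Irr₀(G | D)`: the irreducible characters of `G` of height zero that lie in a block with
defect group `D`. Height zero means that `χ(1)` and `|G : D|` have the same `ℓ`-part. -/
def irrZero {ℓ : ℕ} [Fact ℓ.Prime] (red : integralClosure ℤ ℂ →+* AlgebraicClosure (ZMod ℓ))
    {G : Type*} [Group G] (D : Subgroup G) : Set (Irr G) :=
  {χ | (bl red χ).IsDefectGroup D ∧
    ∃ n : ℕ, χ 1 = (n : ℂ) ∧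
      padicValNat ℓ n + padicValNat ℓ (Nat.card D) = padicValNat ℓ (Nat.card G)}

/-! ### Groups -/

/-- `Q` is an `ℓ`-radical subgroup of `G`: an `ℓ`-subgroup that is the largest normal
`ℓ`-subgroup of its normalizer. -/
def IsRadicalSubgroup (ℓ : ℕ) {G : Type*} [Group G] (Q : Subgroup G) : Prop :=
  IsPGroup ℓ Q ∧
    ∀ P : Subgroup (Subgroup.normalizer (Q : Set G)), P.Normal → IsPGroup ℓ P →
      P ≤ Q.subgroupOf (Subgroup.normalizer (Q : Set G))

/-- `π : G → S` is a surjective homomorphism with central kernel, finite of order prime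
to `ℓ`. -/
def IsCentralPrimeToExtension (ℓ : ℕ) {G S : Type*} [Group G] [Group S] (π : G →* S) : Prop :=
  Function.Surjective π ∧ π.ker ≤ Subgroup.center G ∧ Finite π.ker ∧
    Nat.Coprime ℓ (Nat.card π.ker)

/-- `π : G → S` is the universal `ℓ'`-covering group of the finite group `S`: a perfect central
extension by an `ℓ'`-group that maps to every finite central extension of `S` by an
`ℓ'`-group. Every finite group is isomorphic to one in `Type`, so that it is enough to
let `H` run over these. -/
def IsUniversalPrimeToCovering (ℓ : ℕ) {G S : Type*} [Group G] [Group S] (π : G →* S) : Prop :=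
  Group.IsPerfect G ∧ IsCentralPrimeToExtension ℓ π ∧
    ∀ (H : Type) [Group H] [Finite H] (ψ : H →* S), IsCentralPrimeToExtension ℓ ψ →
      ∃ f : G →* H, ψ.comp f = π

/-- `Aut(S)_χ` for a character `χ` of the universal `ℓ'`-covering group `π : G → S`: the
automorphisms of `S` whose lift to `G` fixes `χ`. -/
def autStabilizer {G S : Type*} [Group G] [Group S] (π : G →* S) (χ : Irr G) :
    Subgroup (MulAut S) where
  carrier := {σ | ∃ α : MulAut G, (∀ g, π (α g) = σ (π g)) ∧ ∀ g, χ (α g) = χ g}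
  one_mem' := ⟨1, fun _ => rfl, fun _ => rfl⟩
  mul_mem' := by
    rintro σ τ ⟨α, h1, h2⟩ ⟨β, h3, h4⟩
    exact ⟨α * β, fun g => by simp [h1, h3], fun g => by simp [h2, h4]⟩
  inv_mem' := by
    rintro σ ⟨α, h1, h2⟩
    refine ⟨α⁻¹, fun g => ?_, fun g => ?_⟩
    · apply σ.injective
      rw [← h1]
      simp
    · rw [← h2]
      simp

/-- The group `A = G ⋊ ⟨η⟩` for an automorphism `η` of `G`. -/
abbrev CyclicExt {G : Type*} [Group G] (η : MulAut G) : Type _ :=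
  G ⋊[(Subgroup.zpowers η).subtype] (Subgroup.zpowers η)

/-- The inclusion of `G` in `A = G ⋊ ⟨η⟩`. -/
abbrev CyclicExt.incl {G : Type*} [Group G] (η : MulAut G) : G →* CyclicExt η :=
  SemidirectProduct.inl

/-- `N_A(Q)` for a subgroup `Q` of `G` and `A = G ⋊ ⟨η⟩`. -/
def CyclicExt.normalizer {G : Type*} [Group G] (η : MulAut G) (Q : Subgroup G) :
    Subgroup (CyclicExt η) :=
  Subgroup.normalizer (Q.map (CyclicExt.incl η) : Set (CyclicExt η))

/-- The inclusion of `N_G(Q)` in `N_A(Q)`, where `A = G ⋊ ⟨η⟩`. -/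
def CyclicExt.normalizerIncl {G : Type*} [Group G] (η : MulAut G) (Q : Subgroup G) :
    Subgroup.normalizer (Q : Set G) →* CyclicExt.normalizer η Q :=
  (Subgroup.inclusion (Subgroup.le_normalizer_map (H := Q) (CyclicExt.incl η))).comp
    ((CyclicExt.incl η).subgroupMap (Subgroup.normalizer (Q : Set G)))

/-- The subgroup `A'` of `A = G ⋊ ⟨η⟩` contains `G`, and `A' / G` is the Hall `ℓ'`-subgroup
of the cyclic group `A / G`. -/
def IsHallPrimeToPart (ℓ : ℕ) {G : Type*} [Group G] (η : MulAut G)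
    (A' : Subgroup (CyclicExt η)) : Prop :=
  (CyclicExt.incl η).range ≤ A' ∧
    Nat.Coprime ℓ ((CyclicExt.incl η).range.relIndex A') ∧ ∃ k : ℕ, A'.index = ℓ ^ k

/-! ### The first two conditions of the inductive Alperin-McKay condition -/

/-- The first two conditions of the inductive Alperin-McKay condition, for a subgroup `M = M_Q`
of `G` and a bijection `Ω = Ω_Q`. (The requirement that `M` be a proper subgroup of `G` is left
out.) The first two fields are condition (i): `M` contains `N_G(Q)` and is stable under the
automorphisms of `G` that stabilize `Q`. The other three are condition (ii): the bijection `Ω`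
from `Irr₀(G | Q)` to `Irr₀(M | Q)` commutes with these automorphisms, maps characters over a
character `ν` of the centre of `G` to characters over `ν`, and is compatible with block
induction from `M` to `G`. -/
structure InductiveAMConditions {ℓ : ℕ} [Fact ℓ.Prime]
    (red : integralClosure ℤ ℂ →+* AlgebraicClosure (ZMod ℓ))
    {G : Type*} [Group G] (Q M : Subgroup G)
    (Ω : irrZero red Q ≃ irrZero red (Q.subgroupOf M)) : Prop where
  normalizer_le : Subgroup.normalizer (Q : Set G) ≤ M
  stable : ∀ α : MulAut G, Q.map α.toMonoidHom = Q → M.map α.toMonoidHom = M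
  equivariant : ∀ α : MulAut G, Q.map α.toMonoidHom = Q →
    ∀ χ χ' : irrZero red Q, (∀ g : G, χ'.1 (α g) = χ.1 g) →
      ∀ (m : G) (hm : m ∈ M) (hαm : α m ∈ M), (Ω χ').1 ⟨α m, hαm⟩ = (Ω χ).1 ⟨m, hm⟩
  central : ∀ (ν : Irr (Subgroup.center G)) (χ : irrZero red Q),
    LiesOver (Subgroup.center G).subtype χ.1 ν →
      LiesOver (Subgroup.inclusion
        ((Subgroup.center_le_normalizer (Q : Set G)).trans normalizer_le)) (Ω χ).1 ν
  block_induced : ∀ χ : irrZero red Q,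
    IsInducedBlock M.subtype (bl red (Ω χ).1) (bl red χ.1)

end BlockTheory

end

/-! Write `A = G ⋊ ⟨η⟩` and `φ = Ω χ`. The automorphisms of `G` induced by `A` fix `χ`, and by
equivariance of `Ω` those induced by `N_A(Q)` fix `φ`. An invariant character extends over a cyclic
quotient (`exists_extension`), so both extend, and only the compatibility of blocks has to be
arranged. The freedom used for this is the twist of the extension of `φ` by linear characters of `A
/ G`.

Put `H = A'` and `N' = N_H(Q)`. The centre of `ℤH` is graded by the cyclic group `A / G`, according
to the coset of `G` that carries the support. Two maps from it to the algebraic closure of `𝔽_ℓ` are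
compared: the reduced central character of the extension of `χ`, and restriction to `N'` followed by
that of the extension of `φ`. The second is also a ring homomorphism (`lamHom_res_mul`). This is the
Brauer homomorphism argument: `N'` contains the centralizer of `Q`, and modulo `ℓ` a class function
of `N'` that vanishes on the centralizer of `Q` is nilpotent.

In degree `1` both maps are computed in `G` and `N_G(Q)`, where they agree by the given block
induction. Two such homomorphisms differ by a character of the grading group
(`exists_pow_mul_eq_of_eqOn_one`). Its value at a generator is a root of unity, which lifts to `ℂ`.
Twisting the extension of `φ` by the resulting linear character makes the two maps equal, which is
block induction. The linear character lives on all of `⟨η⟩`, so it twists the extension to `N_A(Q)`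
itself, and it is trivial on `N_G(Q)`. -/

noncomputable section

open Finset

namespace BlockTheory

/-! ### Ring homomorphisms on graded rings -/

/-- Two ring homomorphisms from a commutative ring graded by a finite cyclic group to an
algebraically closed field that agree in degree `1` differ by a character of the group. -/
theorem exists_pow_mul_eq_of_eqOn_one {R C F : Type*} [CommRing R] [Group C] [Field F]
    [IsAlgClosed F] (gr : C → R → Prop) (hone : gr 1 1)
    (hmul : ∀ a b x y, gr a x → gr b y → gr (a * b) (x * y))
    (f f' : R →+* F) (hff : ∀ x, gr 1 x → f x = f' x) (g : C) {m : ℕ} (hm : 0 < m)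
    (hg : g ^ m = 1) :
    ∃ u : F, u ^ m = 1 ∧ ∀ k x, gr (g ^ k) x → f x = u ^ k * f' x := by
  classical
  have hpow : ∀ a x n, gr a x → gr (a ^ n) (x ^ n) := by
    intro a x n h
    induction n with
    | zero => simpa using hone
    | succ n ih => simpa [pow_succ] using hmul _ _ _ _ ih h
  -- The `m`-th power of a homogeneous element has degree `1`, so `f` and `f'` vanish on the same
  -- homogeneous elements.
  have hfm : ∀ k x, gr (g ^ k) x → f x ^ m = f' x ^ m := by
    intro k x h
    rw [← map_pow, ← map_pow]
    apply hff
    have := hpow _ _ m h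
    rwa [← pow_mul, mul_comm k, pow_mul, hg, one_pow] at this
  have hex : ∃ k, 0 < k ∧ ∃ x, gr (g ^ k) x ∧ f x ≠ 0 := ⟨m, hm, 1, by simpa [hg], by simp⟩
  -- The exponents `k` with `f` nonzero in degree `g ^ k` turn out to be multiples of the least
  -- positive one, `d`. Hence a `d`-th root `u` of `f y / f' y` determines everything.
  set d := Nat.find hex with hd
  obtain ⟨hd0, y, hy, hfy⟩ := Nat.find_spec hex
  rw [← hd] at hd0 hy
  have hfy' : f' y ≠ 0 := fun h => by
    have := hfm _ _ hy
    rw [h, zero_pow hm.ne'] at this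
    exact hfy (pow_eq_zero_iff hm.ne' |>.mp this)
  obtain ⟨u, hu⟩ := IsAlgClosed.exists_pow_nat_eq (f y / f' y) hd0
  have hc : (f y / f' y) ^ m = 1 := by
    rw [div_pow, hfm _ _ hy, div_self (pow_ne_zero _ hfy')]
  have key : ∀ k x, gr (g ^ k) x → f x = u ^ k * f' x := by
    intro k x hx
    by_cases h0 : f x = 0
    · have : f' x = 0 := by
        have := hfm _ _ hx
        rw [h0, zero_pow hm.ne'] at this
        exact pow_eq_zero_iff hm.ne' |>.mp this.symm
      rw [h0, this, mul_zero]
    set q := k / d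
    -- Since `g ^ m = 1`, the factor `y ^ ((m - 1) * q)` has the degree of an inverse of `y ^ q`,
    -- although `y` need not be invertible. Minimality of `d` then gives `k % d = 0`, and the
    -- product has degree `1`.
    have hgr : gr (g ^ (k % d)) (x * y ^ ((m - 1) * q)) := by
      have h1 := hmul _ _ _ _ hx (hpow _ _ ((m - 1) * q) hy)
      have h2 : k + d * ((m - 1) * q) = k % d + m * (d * q) := by
        have h3 : k % d + d * q = k := Nat.mod_add_div k d
        obtain ⟨m, rfl⟩ := Nat.exists_eq_succ_of_ne_zero hm.ne'
        simp only [Nat.succ_eq_add_one, Nat.add_sub_cancel]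
        conv_lhs => rw [← h3]
        ring
      rw [← pow_mul, ← pow_add, h2, pow_add, pow_mul g m, hg, one_pow, mul_one] at h1
      exact h1
    have hr : k % d = 0 := by
      by_contra hne
      exact Nat.find_min hex (Nat.mod_lt k hd0) ⟨Nat.pos_of_ne_zero hne, _, hgr, by
        simp [h0, hfy]⟩
    rw [hr, pow_zero] at hgr
    have h1 := hff _ hgr
    have hk : k = d * q := by
      have := Nat.mod_add_div k d
      rw [hr, zero_add] at this
      exact this.symm
    have hcq : (f y / f' y) ^ ((m - 1) * q) * (f y / f' y) ^ q = 1 := by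
      rw [← pow_add, ← Nat.succ_mul, Nat.succ_eq_add_one, Nat.sub_add_cancel hm, pow_mul, hc,
        one_pow]
    rw [hk, pow_mul, hu]
    rw [map_mul, map_mul, map_pow, map_pow] at h1
    have h2 : f y ^ ((m - 1) * q) = (f y / f' y) ^ ((m - 1) * q) * f' y ^ ((m - 1) * q) := by
      rw [← mul_pow, div_mul_cancel₀ _ hfy']
    rw [h2] at h1
    have h3 : f x * (f y / f' y) ^ ((m - 1) * q) = f' x := by
      apply mul_right_cancel₀ (pow_ne_zero ((m - 1) * q) hfy')
      rw [mul_assoc, h1]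
    rw [← h3, mul_comm, mul_assoc, hcq, mul_one]
  refine ⟨u, ?_, key⟩
  have := key m 1 (by simpa [hg])
  simpa using this.symm

/-- Roots of unity lift along a ring homomorphism on the ring of algebraic integers. -/
theorem exists_pow_eq_one_map_eq {F : Type*} [Field F] (red : integralClosure ℤ ℂ →+* F)
    {m : ℕ} (hm : 0 < m) {u : F} (hu : u ^ m = 1) :
    ∃ z : integralClosure ℤ ℂ, z ^ m = 1 ∧ red z = u := by
  have hζ := Complex.isPrimitiveRoot_exp m hm.ne'
  set ζ := Complex.exp (2 * Real.pi * Complex.I / m)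
  have hint : IsIntegral ℤ ζ := hζ.isIntegral hm
  set ζ' : integralClosure ℤ ℂ := ⟨ζ, hint⟩
  have hζ' : IsPrimitiveRoot ζ' m :=
    IsPrimitiveRoot.of_map_of_injective (f := algebraMap (integralClosure ℤ ℂ) ℂ) hζ
      Subtype.val_injective
  -- Reducing the factorization of `X ^ m - 1` and evaluating at `u` makes some factor vanish. This
  -- needs no assumption that `ℓ` is prime to `m`.
  have h := Polynomial.X_pow_sub_one_eq_prod hm hζ'
  have h2 := congrArg (Polynomial.eval₂ red u) h
  rw [Polynomial.eval₂_finsetProd] at h2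
  simp only [Polynomial.eval₂_sub, Polynomial.eval₂_X_pow, Polynomial.eval₂_one, hu, sub_self,
    Polynomial.eval₂_X, Polynomial.eval₂_C] at h2
  obtain ⟨z, hz, hz2⟩ := Finset.prod_eq_zero_iff.mp h2.symm
  exact ⟨z, (Polynomial.mem_nthRootsFinset hm _).mp hz, (sub_eq_zero.mp hz2).symm⟩

/-! ### Sums over sets with an action of an `ℓ`-group -/

/-- In characteristic `ℓ`, the sum of an invariant function over a set with an action of an
`ℓ`-group is zero if the function vanishes on the fixed points. -/
theorem sum_eq_zero_of_isPGroup {ℓ : ℕ} [Fact ℓ.Prime] {Q X A : Type*} [Group Q]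
    (hQ : IsPGroup ℓ Q) [MulAction Q X] [Fintype X] [Ring A] [CharP A ℓ] (f : X → A)
    (hf : ∀ (q : Q) x, f (q • x) = f x) (hfix : ∀ x, (∀ q : Q, q • x = x) → f x = 0) :
    ∑ x, f x = 0 := by
  classical
  -- Each fibre of `f` is stable under `Q`. Over a nonzero value it has no fixed points, so its
  -- cardinality is divisible by `ℓ`.
  rw [← Finset.sum_fiberwise_of_maps_to (g := f) (t := univ.image f)
    (fun x _ => mem_image_of_mem f (mem_univ x))]
  refine sum_eq_zero fun c _ => ?_
  rw [sum_congr rfl (g := fun _ => c) (fun x hx => (mem_filter.mp hx).2), sum_const]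
  by_cases hc : c = 0
  · simp [hc]
  let _ : MulAction Q {x // f x = c} :=
    { smul := fun q x => ⟨q • x.1, by rw [hf]; exact x.2⟩
      one_smul := fun x => Subtype.ext (one_smul Q x.1)
      mul_smul := fun a b x => Subtype.ext (mul_smul a b x.1) }
  have h := hQ.card_modEq_card_fixedPoints {x // f x = c}
  have h0 : IsEmpty (MulAction.fixedPoints Q {x // f x = c}) :=
    ⟨fun x => hc (x.1.2.symm.trans (hfix x.1.1 fun q => congrArg Subtype.val (x.2 q)))⟩
  rw [Nat.card_of_isEmpty (α := MulAction.fixedPoints Q {x // f x = c}),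
    Nat.modEq_zero_iff_dvd, Nat.card_eq_fintype_card,
    Fintype.card_subtype, ← CharP.cast_eq_zero_iff A ℓ] at h
  rw [nsmul_eq_mul, h, zero_mul]

/-! ### Irreducible representations -/

/-- Schur's lemma for endomorphisms that commute with an irreducible representation. -/
theorem exists_eq_smul_one_of_commute {G V : Type*} [Group G] [AddCommGroup V] [Module ℂ V]
    [FiniteDimensional ℂ V] (ρ : Representation ℂ G V) [ρ.IsIrreducible] (T : V →ₗ[ℂ] V)
    (hT : ∀ g, T * ρ g = ρ g * T) : ∃ c : ℂ, T = c • (1 : V →ₗ[ℂ] V) := by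
  let f : Representation.IntertwiningMap ρ ρ := ⟨T, hT⟩
  obtain ⟨c, hc⟩ :=
    (Representation.IsIrreducible.algebraMap_intertwiningMap_bijective_of_isAlgClosed (ρ := ρ)).2 f
  refine ⟨c, ?_⟩
  have := congrArg Representation.IntertwiningMap.toLinearMap hc
  exact this.symm

/-- Irreducible representations of a finite group with the same character are equivalent. -/
theorem nonempty_equiv_of_character_eq {G V W : Type*} [Group G] [Finite G] [AddCommGroup V]
    [Module ℂ V] [FiniteDimensional ℂ V] [AddCommGroup W] [Module ℂ W] [FiniteDimensional ℂ W]
    (ρ : Representation ℂ G V) (σ : Representation ℂ G W) [ρ.IsIrreducible] [σ.IsIrreducible]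
    (h : ρ.character = σ.character) : Nonempty (ρ.Equiv σ) := by
  classical
  have := Fintype.ofFinite G
  have : Invertible (Nat.card G : ℂ) :=
    invertibleOfNonzero (Nat.cast_ne_zero.mpr Nat.card_pos.ne')
  have h1 := Representation.char_orthonormal σ ρ
  have h2 := Representation.char_orthonormal ρ ρ
  rw [if_pos ⟨Representation.Equiv.refl ρ⟩] at h2
  by_contra hne
  rw [if_neg hne, ← h, h2] at h1
  exact one_ne_zero h1

theorem isIrreducible_iff {G V : Type*} [Group G] [AddCommGroup V] [Module ℂ V]
    (ρ : Representation ℂ G V) : ρ.IsIrreducible ↔ Nontrivial V ∧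
      ∀ U : Submodule ℂ V, (∀ g, ∀ v ∈ U, ρ g v ∈ U) → U = ⊥ ∨ U = ⊤ := by
  constructor
  · intro h
    refine ⟨?_, fun U hU => ?_⟩
    · by_contra hV
      rw [not_nontrivial_iff_subsingleton] at hV
      refine bot_ne_top (α := Subrepresentation ρ) (Subrepresentation.toSubmodule_injective ?_)
      exact Subsingleton.elim _ _
    · rcases eq_bot_or_eq_top (⟨U, hU⟩ : Subrepresentation ρ) with h | h
      · exact Or.inl (congrArg Subrepresentation.toSubmodule h)
      · exact Or.inr (congrArg Subrepresentation.toSubmodule h)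
  · rintro ⟨hV, h⟩
    refine { exists_pair_ne := ⟨⊥, ⊤, fun h => ?_⟩, eq_bot_or_eq_top := fun U => ?_ }
    · exact bot_ne_top (α := Submodule ℂ V) (congrArg Subrepresentation.toSubmodule h)
    · rcases h U.toSubmodule (fun g v hv => U.apply_mem_toSubmodule g hv) with h | h
      · exact Or.inl (Subrepresentation.toSubmodule_injective h)
      · exact Or.inr (Subrepresentation.toSubmodule_injective h)

/-- A representation whose restriction along a homomorphism is irreducible is irreducible. -/
theorem isIrreducible_of_comp {N M V : Type*} [Group N] [Group M] [AddCommGroup V] [Module ℂ V]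
    (f : N →* M) (ρ : Representation ℂ M V)
    (h : Representation.IsIrreducible (ρ.comp f : Representation ℂ N V)) : ρ.IsIrreducible := by
  rw [isIrreducible_iff] at h ⊢
  exact ⟨h.1, fun U hU => h.2 U fun g => hU (f g)⟩

/-- An irreducible representation composed with a surjective homomorphism is irreducible. -/
theorem isIrreducible_comp_surjective {N M V : Type*} [Group N] [Group M] [AddCommGroup V]
    [Module ℂ V] (f : N →* M) (hf : Function.Surjective f) (ρ : Representation ℂ M V)
    (h : ρ.IsIrreducible) : Representation.IsIrreducible (ρ.comp f : Representation ℂ N V) := by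
  rw [isIrreducible_iff] at h ⊢
  refine ⟨h.1, fun U hU => h.2 U fun m => ?_⟩
  obtain ⟨n, rfl⟩ := hf m
  exact hU n

/-- The twist of an irreducible character by a linear character. -/
theorem isIrredChar_mul_linear {G : Type*} [Group G] {χ : G → ℂ} (hχ : IsIrredChar χ)
    (β : G →* ℂˣ) : IsIrredChar fun g => χ g * (β g : ℂ) := by
  obtain ⟨n, ρ, hρ, rfl⟩ := hχ
  let σ : Representation ℂ G (Fin n → ℂ) :=
    { toFun := fun g => (β g : ℂ) • ρ g
      map_one' := by simp
      map_mul' := fun a b => by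
        simp only [map_mul, Units.val_mul, smul_mul_assoc, mul_smul_comm, smul_smul]
        rw [mul_comm] }
  refine ⟨n, σ, ?_, ?_⟩
  · rw [isIrreducible_iff] at hρ ⊢
    refine ⟨hρ.1, fun U hU => hρ.2 U fun g v hv => ?_⟩
    have := U.smul_mem ((β g : ℂ)⁻¹) (hU g v hv)
    simpa [σ, smul_smul] using this
  · ext g
    simp only [Representation.character, σ]
    change LinearMap.trace ℂ _ ((β g : ℂ) • ρ g) = _
    rw [map_smul, smul_eq_mul, mul_comm]

theorem Irr.conj_apply {G : Type*} [Group G] (χ : Irr G) (g h : G) : χ (h * g * h⁻¹) = χ g := by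
  obtain ⟨χ, n, ρ, hρ, rfl⟩ := χ
  exact Representation.char_conj ρ g h

theorem Irr.apply_one_ne_zero {G : Type*} [Group G] (χ : Irr G) : χ 1 ≠ 0 := by
  obtain ⟨χ, n, ρ, hρ, rfl⟩ := χ
  change ρ.character 1 ≠ 0
  rw [Representation.char_one, Nat.cast_ne_zero, Module.finrank_fin_fun]
  rintro rfl
  have := ((isIrreducible_iff ρ).mp hρ).1
  exact not_subsingleton (Fin 0 → ℂ) inferInstance

/-! ### Extension of invariant characters -/

/-- Every element of `M` has the form `i n * t ^ k`, and `ρ n * T ^ k` is the only possible image.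
Two such expressions differ by a power of `t ^ orderOf (p t) = i n₀`, so `hT₀` is exactly what makes
this well defined. -/
theorem exists_extension_of_intertwiner {N M C V : Type*} [Group N] [Group M] [Finite M] [Group C]
    [AddCommGroup V] [Module ℂ V]
    (i : N →* M) (hi : Function.Injective i) (p : M →* C) (hp : p.ker = i.range)
    (t : M) (ht : ∀ x, ∃ k : ℕ, p x = p t ^ k) (s : N →* N) (hs : ∀ n, i (s n) = t * i n * t⁻¹)
    (n₀ : N) (hn₀ : i n₀ = t ^ orderOf (p t)) (ρ : Representation ℂ N V) (T : V →ₗ[ℂ] V)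
    (hT : ∀ n, T * ρ n = ρ (s n) * T) (hT₀ : T ^ orderOf (p t) = ρ n₀) :
    ∃ σ : Representation ℂ M V, ∀ n, σ (i n) = ρ n := by
  have hpi : ∀ n, p (i n) = 1 := fun n => by
    rw [← MonoidHom.mem_ker, hp]
    exact ⟨n, rfl⟩
  have hTk : ∀ (k : ℕ) n, T ^ k * ρ n = ρ (s^[k] n) * T ^ k := by
    intro k
    induction k with
    | zero => simp
    | succ k ih =>
      intro n
      rw [pow_succ, mul_assoc, hT, ← mul_assoc, ih, mul_assoc, Function.iterate_succ_apply]
  have hsk : ∀ (k : ℕ) n, i (s^[k] n) = t ^ k * i n * (t ^ k)⁻¹ := by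
    intro k
    induction k with
    | zero => simp
    | succ k ih =>
      intro n
      rw [Function.iterate_succ_apply, ih, hs, pow_succ]
      group
  have hwd' : ∀ n n' (k l : ℕ), i n * t ^ k = i n' * t ^ (k + l) →
      ρ n * T ^ k = ρ n' * T ^ (k + l) := by
    intro n n' k l h
    have h1 : i n = i n' * t ^ l := by
      apply mul_right_cancel (b := t ^ k)
      rw [h, mul_assoc, ← pow_add, add_comm]
    have h2 : p t ^ l = 1 := by
      have := congrArg p h1
      rwa [map_mul, hpi, hpi, one_mul, map_pow, eq_comm] at this
    obtain ⟨q, rfl⟩ := orderOf_dvd_of_pow_eq_one h2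
    have h3 : n = n' * n₀ ^ q := hi (by rw [h1, map_mul, map_pow, hn₀, ← pow_mul])
    rw [h3, map_mul, map_pow, ← hT₀, ← pow_mul, mul_assoc, ← pow_add, add_comm]
  have hwd : ∀ n n' (k l : ℕ), i n * t ^ k = i n' * t ^ l → ρ n * T ^ k = ρ n' * T ^ l := by
    intro n n' k l h
    rcases le_total k l with hkl | hkl
    · obtain ⟨j, rfl⟩ := Nat.exists_eq_add_of_le hkl
      exact hwd' _ _ _ _ h
    · obtain ⟨j, rfl⟩ := Nat.exists_eq_add_of_le hkl
      exact (hwd' _ _ _ _ h.symm).symm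
  have hex : ∀ x, ∃ nk : N × ℕ, x = i nk.1 * t ^ nk.2 := by
    intro x
    obtain ⟨k, hk⟩ := ht x
    have : x * (t ^ k)⁻¹ ∈ p.ker := by
      rw [MonoidHom.mem_ker, map_mul, map_inv, map_pow, hk, mul_inv_cancel]
    rw [hp] at this
    obtain ⟨n, hn⟩ := this
    exact ⟨(n, k), by rw [hn, inv_mul_cancel_right]⟩
  choose c hc using hex
  have hext : ∀ n (k : ℕ), ρ (c (i n * t ^ k)).1 * T ^ (c (i n * t ^ k)).2 = ρ n * T ^ k :=
    fun n k => hwd _ _ _ _ (hc _).symm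
  refine ⟨{ toFun := fun x => ρ (c x).1 * T ^ (c x).2, map_one' := ?_, map_mul' := ?_ }, ?_⟩
  · simpa using hext 1 0
  · intro x y
    have hxy : x * y = i ((c x).1 * s^[(c x).2] (c y).1) * t ^ ((c x).2 + (c y).2) := by
      conv_lhs => rw [hc x, hc y]
      rw [map_mul, hsk, pow_add]
      group
    rw [hxy, hext, map_mul, mul_assoc, mul_assoc, pow_add, ← mul_assoc (ρ _) (T ^ _) (T ^ _),
      ← hTk]
    simp only [mul_assoc]
  · intro n
    simpa using hext n 0

/-- An irreducible character of a normal subgroup with cyclic quotient that is invariant under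
conjugation extends. -/
theorem exists_extension {N M C : Type*} [Group N] [Group M] [Finite M] [Group C] [IsCyclic C]
    (i : N →* M) (hi : Function.Injective i) (p : M →* C) (hp : p.ker = i.range) (χ : Irr N)
    (hχ : ∀ m n n', i n' = m * i n * m⁻¹ → χ n' = χ n) :
    ∃ (d : ℕ) (σ : Representation ℂ M (Fin d → ℂ)),
      Representation.IsIrreducible (σ.comp i : Representation ℂ N (Fin d → ℂ)) ∧
        ∀ n, σ.character (i n) = χ n := by
  have hfin : Finite N := Finite.of_injective i hi
  obtain ⟨χ, d, ρ, hρ, rfl⟩ := χ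
  replace hχ : ∀ m n n', i n' = m * i n * m⁻¹ → ρ.character n' = ρ.character n := hχ
  obtain ⟨⟨_, t, rfl⟩, hc⟩ := IsCyclic.exists_generator (α := p.range)
  have ht : ∀ x, ∃ k : ℕ, p x = p t ^ k := by
    intro x
    have := hc ⟨p x, x, rfl⟩
    classical
    have hfin' : Finite p.range := Set.finite_range p |>.to_subtype
    rw [mem_zpowers_iff_mem_range_orderOf (x := (⟨p t, t, rfl⟩ : p.range))] at this
    obtain ⟨k, -, hk⟩ := Finset.mem_image.mp this
    exact ⟨k, (congrArg Subtype.val hk).symm⟩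
  have hnorm : i.range.Normal := hp ▸ MonoidHom.normal_ker p
  let e : N ≃* i.range := MonoidHom.ofInjective hi
  let s : N ≃* N := e.trans ((MulAut.conjNormal t).trans e.symm)
  have hs : ∀ n, i (s n) = t * i n * t⁻¹ := by
    intro n
    have h : ((e (s n) : i.range) : M) = t * i n * t⁻¹ := by
      simp only [s, MulEquiv.trans_apply, MulEquiv.apply_symm_apply]
      rw [MulAut.conjNormal_apply]
      rfl
    exact h
  have hn₀ : ∃ n₀, i n₀ = t ^ orderOf (p t) := by
    change _ ∈ i.range
    rw [← hp, MonoidHom.mem_ker, map_pow, pow_orderOf_eq_one]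
  obtain ⟨n₀, hn₀⟩ := hn₀
  have hσ : Representation.IsIrreducible (ρ.comp s.toMonoidHom : Representation ℂ N _) :=
    isIrreducible_comp_surjective _ s.surjective ρ hρ
  obtain ⟨E⟩ := nonempty_equiv_of_character_eq ρ (ρ.comp s.toMonoidHom : Representation ℂ N _)
    (by
      ext n
      exact (hχ t n (s n) (hs n)).symm)
  let T : (Fin d → ℂ) →ₗ[ℂ] (Fin d → ℂ) := E.toIntertwiningMap.toLinearMap
  have hT : ∀ n, T * ρ n = ρ (s n) * T := E.toIntertwiningMap.isIntertwining'
  have hTbij : Function.Bijective T := E.toLinearEquiv.bijective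
  have hd : orderOf (p t) ≠ 0 := (orderOf_pos_iff.mpr (by
    have := isOfFinOrder_of_finite t
    exact p.isOfFinOrder this)).ne'
  have hTk : ∀ (k : ℕ) n, ∃ n', i n' = t ^ k * i n * (t ^ k)⁻¹ ∧ T ^ k * ρ n = ρ n' * T ^ k := by
    intro k
    induction k with
    | zero => exact fun n => ⟨n, by simp⟩
    | succ k ih =>
      intro n
      obtain ⟨n', h1, h2⟩ := ih (s n)
      refine ⟨n', ?_, ?_⟩
      · rw [h1, hs, pow_succ]
        group
      · rw [pow_succ, mul_assoc, hT, ← mul_assoc, h2, mul_assoc]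
  -- With `k = orderOf (p t)`, both `T ^ k` and `ρ n₀` induce conjugation by `n₀`, so Schur's lemma
  -- makes them proportional. Rescaling `T` by a `k`-th root of `c⁻¹` makes them equal.
  obtain ⟨c, hcT⟩ := exists_eq_smul_one_of_commute ρ (ρ n₀⁻¹ * T ^ orderOf (p t)) (by
    intro n
    obtain ⟨n', h1, h2⟩ := hTk (orderOf (p t)) n
    have h3 : n' = n₀ * n * n₀⁻¹ := hi (by rw [h1, map_mul, map_mul, map_inv, hn₀])
    rw [mul_assoc, h2, h3, ← mul_assoc, ← mul_assoc, ← map_mul, ← map_mul]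
    congr 2
    group)
  have hTd : T ^ orderOf (p t) = c • ρ n₀ := by
    have := congrArg (ρ n₀ * ·) hcT
    simpa [← mul_assoc, ← map_mul] using this
  have hVne : ∃ v : Fin d → ℂ, v ≠ 0 :=
    have := ((isIrreducible_iff ρ).mp hρ).1
    exists_ne 0
  have hc0 : c ≠ 0 := by
    rintro rfl
    obtain ⟨v, hv⟩ := hVne
    rw [zero_smul] at hTd
    have h1 : Function.Injective (T ^ orderOf (p t)) := by
      rw [Module.End.coe_pow]
      exact hTbij.1.iterate _
    exact hv (h1 (by rw [hTd]; simp))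
  obtain ⟨a, ha⟩ := IsAlgClosed.exists_pow_nat_eq c⁻¹ (Nat.pos_of_ne_zero hd)
  obtain ⟨σ, hσ⟩ := exists_extension_of_intertwiner i hi p hp t ht s.toMonoidHom hs n₀ hn₀ ρ
    (a • T) (fun n => by
      rw [smul_mul_assoc, hT, mul_smul_comm]
      rfl) (by
      rw [smul_pow, ha, hTd, smul_smul, inv_mul_cancel₀ hc0, one_smul])
  refine ⟨d, σ, ?_, fun n => ?_⟩
  · have : (σ.comp i : Representation ℂ N _) = ρ := MonoidHom.ext hσ
    rw [this]
    exact hρ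
  · change LinearMap.trace ℂ _ (σ (i n)) = _
    rw [hσ]
    rfl

/-! ### The centre of the group algebra -/

/-- The centre of the integral group ring. -/
abbrev ClassRing (G : Type*) [Group G] := Subring.center (MonoidAlgebra ℤ G)

theorem coeff_mul_eq_sum {R G : Type*} [Semiring R] [Group G] [Fintype G]
    (x y : MonoidAlgebra R G) (g : G) :
    (x * y).coeff g = ∑ h, x.coeff h * y.coeff (h⁻¹ * g) := by
  rw [MonoidAlgebra.coeff_mul_apply_left, Finsupp.sum_fintype]
  simp

theorem mem_center_iff_coeff {R G : Type*} [CommRing R] [Group G] (z : MonoidAlgebra R G) :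
    z ∈ Subring.center (MonoidAlgebra R G) ↔ ∀ g h, z.coeff (g * h * g⁻¹) = z.coeff h := by
  rw [Subring.mem_center_iff]
  constructor
  · intro hz g h
    have := congrArg (fun w => MonoidAlgebra.coeff w (g * h)) (hz (MonoidAlgebra.single g 1))
    simp only [MonoidAlgebra.coeff_single_mul_apply, MonoidAlgebra.coeff_mul_single_apply, one_mul,
      mul_one, inv_mul_cancel_left] at this
    exact this.symm
  · intro hz w
    induction w using MonoidAlgebra.induction_linear with
    | zero => simp
    | add a b ha hb => rw [add_mul, mul_add, ha, hb]
    | single g r =>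
      ext h
      rw [MonoidAlgebra.coeff_single_mul_apply, MonoidAlgebra.coeff_mul_single_apply, mul_comm r,
        ← hz g (g⁻¹ * h)]
      congr 2
      group

theorem ClassRing.coeff_conj {G : Type*} [Group G] (z : ClassRing G) (g h : G) :
    z.1.coeff (g * h * g⁻¹) = z.1.coeff h :=
  (mem_center_iff_coeff z.1).mp z.2 g h

theorem ClassRing.coeff_eq_of_isConj {G : Type*} [Group G] (z : ClassRing G) {g h : G}
    (hgh : IsConj g h) : z.1.coeff g = z.1.coeff h := by
  obtain ⟨c, rfl⟩ := isConj_iff.mp hgh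
  exact (ClassRing.coeff_conj z c g).symm

/-- The class function with given coefficients, as an element of the centre. -/
def ClassRing.ofFun {G : Type*} [Group G] [Finite G] (a : ConjClasses G → ℤ) : ClassRing G :=
  ⟨MonoidAlgebra.ofCoeff (Finsupp.equivFunOnFinite.symm fun g => a (ConjClasses.mk g)),
    (mem_center_iff_coeff _).mpr fun g _ => congrArg a
      (ConjClasses.mk_eq_mk_iff_isConj.mpr (isConj_iff.mpr ⟨g, rfl⟩)).symm⟩

@[simp]
theorem ClassRing.coeff_ofFun {G : Type*} [Group G] [Finite G] (a : ConjClasses G → ℤ) (g : G) :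
    (ClassRing.ofFun a).1.coeff g = a (ConjClasses.mk g) := rfl

theorem ClassRing.ext_coeff {G : Type*} [Group G] {z w : ClassRing G}
    (h : ∀ g, z.1.coeff g = w.1.coeff g) : z = w :=
  Subtype.ext (MonoidAlgebra.coeff_injective (Finsupp.ext h))

/-- The sum of a conjugacy class. -/
def classSum {G : Type*} [Group G] [Finite G] (K : ConjClasses G) : ClassRing G :=
  open Classical in ClassRing.ofFun (Pi.single K 1)

theorem coeff_classSum {G : Type*} [Group G] [Finite G] (K : ConjClasses G) (g : G)
    [Decidable (ConjClasses.mk g = K)] :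
    (classSum K).1.coeff g = if ConjClasses.mk g = K then 1 else 0 := by
  simp [classSum, Pi.single_apply]

/-- Evaluation of coefficients, as an additive homomorphism. -/
def ClassRing.coeffHom {G : Type*} [Group G] (g : G) : ClassRing G →+ ℤ where
  toFun z := z.1.coeff g
  map_zero' := rfl
  map_add' _ _ := rfl

theorem ClassRing.eq_sum_classSum {G : Type*} [Group G] [Finite G] [Fintype (ConjClasses G)]
    (z : ClassRing G) : z = ∑ K, z.1.coeff K.exists_rep.choose • classSum K := by
  classical
  apply ClassRing.ext_coeff
  intro g
  change ClassRing.coeffHom g z = ClassRing.coeffHom g _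
  rw [map_sum, sum_eq_single (ConjClasses.mk g)]
  · rw [map_zsmul]
    change z.1.coeff g = _ • (classSum (ConjClasses.mk g)).1.coeff g
    rw [coeff_classSum, if_pos rfl, smul_eq_mul, mul_one]
    exact ClassRing.coeff_eq_of_isConj z
      (ConjClasses.mk_eq_mk_iff_isConj.mp (ConjClasses.mk g).exists_rep.choose_spec.symm)
  · intro K _ hK
    rw [map_zsmul]
    change _ • (classSum K).1.coeff g = 0
    rw [coeff_classSum, if_neg hK.symm, smul_zero]
  · simp

theorem ClassRing.addHom_ext {G A : Type*} [Group G] [Finite G] [AddCommGroup A]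
    {f f' : ClassRing G →+ A} (h : ∀ K, f (classSum K) = f' (classSum K)) : f = f' := by
  have := Fintype.ofFinite (ConjClasses G)
  ext z
  rw [ClassRing.eq_sum_classSum z]
  simp only [map_sum, map_zsmul, h]

/-- Restriction of class functions along an injective homomorphism. -/
def ClassRing.res {H G : Type*} [Group H] [Group G] (f : H →* G) (hf : Function.Injective f) :
    ClassRing G →+ ClassRing H where
  toFun z := ⟨MonoidAlgebra.ofCoeff (z.1.coeff.comapDomain f hf.injOn), by
    rw [mem_center_iff_coeff]
    intro g h
    simp only [Finsupp.comapDomain_apply, map_mul, map_inv]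
    exact ClassRing.coeff_conj z _ _⟩
  map_zero' := by
    apply ClassRing.ext_coeff
    intro g
    rfl
  map_add' x y := by
    apply ClassRing.ext_coeff
    intro g
    rfl

@[simp]
theorem ClassRing.coeff_res {H G : Type*} [Group H] [Group G] (f : H →* G)
    (hf : Function.Injective f) (z : ClassRing G) (h : H) :
    (ClassRing.res f hf z).1.coeff h = z.1.coeff (f h) := rfl

/-- Both sides are the indicator function of the preimage of `K`. This turns the sum over classes in
`IsInducedBlock` into the additive map `ClassRing.res`. -/
theorem res_classSum {H G : Type*} [Group H] [Finite H] [Group G] [Finite G] (f : H →* G)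
    (hf : Function.Injective f) (K : ConjClasses G)
    [Fintype {L : ConjClasses H // ConjClasses.map f L = K}] :
    ClassRing.res f hf (classSum K) =
      ∑ L : {L : ConjClasses H // ConjClasses.map f L = K}, classSum L.1 := by
  classical
  apply ClassRing.ext_coeff
  intro h
  have h1 : (∑ L : {L : ConjClasses H // ConjClasses.map f L = K}, classSum L.1 :
      ClassRing H).1.coeff h =
      ∑ L : {L : ConjClasses H // ConjClasses.map f L = K}, (classSum L.1).1.coeff h :=
    map_sum (ClassRing.coeffHom h) _ _
  have hmap : ConjClasses.map f (ConjClasses.mk h) = ConjClasses.mk (f h) := rfl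
  rw [h1, ClassRing.coeff_res, coeff_classSum]
  simp only [coeff_classSum]
  by_cases hK : ConjClasses.mk (f h) = K
  · rw [if_pos hK, sum_eq_single ⟨ConjClasses.mk h, hK⟩]
    · rw [if_pos rfl]
    · intro L _ hL
      exact if_neg fun h => hL (Subtype.ext h.symm)
    · simp
  · rw [if_neg hK, sum_eq_zero]
    intro L _
    refine if_neg fun h => hK ?_
    rw [← hmap, h, L.2]

/-! ### Central characters as ring homomorphisms -/

/-- A central element acts by a scalar, by Schur's lemma, and comparing traces finds the scalar. -/
theorem lift_eq_smul_one {G : Type*} [Group G] [Fintype G] {n : ℕ}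
    (ρ : Representation ℂ G (Fin n → ℂ)) (hρ : ρ.IsIrreducible) (z : ClassRing G) :
    MonoidAlgebra.lift ℤ ((Fin n → ℂ) →ₗ[ℂ] (Fin n → ℂ)) G ρ z.1 =
      algebraMap ℂ _ ((∑ g, (z.1.coeff g : ℂ) * ρ.character g) / ρ.character 1) := by
  obtain ⟨c, hc⟩ := exists_eq_smul_one_of_commute ρ (MonoidAlgebra.lift ℤ _ G ρ z.1) fun g => by
    rw [← MonoidAlgebra.lift_of (R := ℤ) ρ g, ← map_mul, ← map_mul,
      Subring.mem_center_iff.mp z.2 (MonoidAlgebra.of ℤ G g)]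
  have h1 := congrArg (LinearMap.trace ℂ _) hc
  rw [map_smul, ← map_one ρ] at h1
  change _ = c • ρ.character 1 at h1
  rw [MonoidAlgebra.lift_apply, Finsupp.sum_fintype _ _ (by simp), map_sum] at h1
  rw [hc, Algebra.algebraMap_eq_smul_one]
  congr 1
  have h2 : ρ.character 1 ≠ 0 := Irr.apply_one_ne_zero ⟨_, n, ρ, hρ, rfl⟩
  rw [eq_div_iff h2, ← smul_eq_mul, ← h1]
  refine sum_congr rfl fun g _ => ?_
  rw [map_zsmul, zsmul_eq_mul]
  rfl

/-- The central character of an irreducible character, as a ring homomorphism from the centre of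
the integral group ring to the algebraic integers. -/
theorem exists_centralHom {G : Type*} [Group G] [Finite G] (χ : Irr G) :
    ∃ ω : ClassRing G →+* integralClosure ℤ ℂ,
      ∀ [Fintype G] z, (ω z : ℂ) = (∑ g, (z.1.coeff g : ℂ) * χ g) / χ 1 := by
  have hG := Fintype.ofFinite G
  obtain ⟨χ, n, ρ, hρ, rfl⟩ := χ
  have := ((isIrreducible_iff ρ).mp hρ).1
  set A := (Fin n → ℂ) →ₗ[ℂ] (Fin n → ℂ)
  set c : ClassRing G → ℂ := fun z => (∑ g, (z.1.coeff g : ℂ) * ρ.character g) / ρ.character 1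
  have hc : ∀ z : ClassRing G, MonoidAlgebra.lift ℤ A G ρ z.1 = algebraMap ℂ A (c z) :=
    lift_eq_smul_one ρ hρ
  have hinj : Function.Injective (algebraMap ℂ A) := FaithfulSMul.algebraMap_injective ℂ A
  let ω : ClassRing G →+* ℂ :=
    { toFun := c
      map_one' := hinj (by rw [← hc, map_one]; exact map_one _)
      map_mul' := fun x y => hinj (by rw [← hc, map_mul, ← hc, ← hc]; exact map_mul _ _ _)
      map_zero' := hinj (by rw [← hc, map_zero]; exact map_zero _)
      map_add' := fun x y => hinj (by rw [← hc, map_add, ← hc, ← hc]; exact map_add _ _ _) }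
  have hfin : Module.Finite ℤ (MonoidAlgebra ℤ G) := inferInstance
  refine ⟨ω.codRestrict (integralClosure ℤ ℂ) fun z => ?_, fun {inst} z => by
    obtain rfl : inst = hG := Subsingleton.elim _ _
    rfl⟩
  -- `ℤG` is a finite `ℤ`-module, so `z` is integral, and so is the scalar by which it acts.
  change IsIntegral ℤ (c z)
  rw [← isIntegral_algebraMap_iff (B := A) hinj, ← hc]
  exact (IsIntegral.of_finite ℤ z.1).map (MonoidAlgebra.lift ℤ A G ρ)

/-- The central character as a ring homomorphism. -/
def centralHom {G : Type*} [Group G] [Finite G] (χ : Irr G) :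
    ClassRing G →+* integralClosure ℤ ℂ :=
  (exists_centralHom χ).choose

theorem centralHom_apply {G : Type*} [Group G] [Fintype G] (χ : Irr G) (z : ClassRing G) :
    (centralHom χ z : ℂ) = (∑ g, (z.1.coeff g : ℂ) * χ g) / χ 1 :=
  (exists_centralHom χ).choose_spec z

theorem centralHom_classSum {G : Type*} [Group G] [Finite G] (χ : Irr G) (K : ConjClasses G) :
    (centralHom χ (classSum K) : ℂ) = centralChar χ K := by
  classical
  have := Fintype.ofFinite G
  rw [centralHom_apply, centralChar]
  congr 1
  simp only [coeff_classSum]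
  have h : ∀ g, ((if ConjClasses.mk g = K then (1 : ℤ) else 0 : ℤ) : ℂ) * χ g =
      if ConjClasses.mk g = K then χ K.exists_rep.choose else 0 := by
    intro g
    split_ifs with hg
    · obtain ⟨c, hc⟩ := isConj_iff.mp
        (ConjClasses.mk_eq_mk_iff_isConj.mp (hg.trans K.exists_rep.choose_spec.symm))
      rw [← hc, Irr.conj_apply]
      simp
    · simp
  rw [sum_congr rfl fun g _ => h g, ← sum_filter, sum_const, nsmul_eq_mul]
  congr 2
  rw [Nat.card_eq_fintype_card, Fintype.card_subtype]
  congr 1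
  ext g
  simp [ConjClasses.mem_carrier_iff_mk_eq]

variable {ℓ : ℕ} [Fact ℓ.Prime] (red : integralClosure ℤ ℂ →+* AlgebraicClosure (ZMod ℓ))

/-- The reduction of the central character as a ring homomorphism. -/
def lamHom {G : Type*} [Group G] [Finite G] (χ : Irr G) :
    ClassRing G →+* AlgebraicClosure (ZMod ℓ) :=
  red.comp (centralHom χ)

theorem lamHom_classSum {G : Type*} [Group G] [Finite G] (χ : Irr G) (K : ConjClasses G) :
    lamHom red χ (classSum K) = lam red χ K := by
  rw [lam, localRed_eq red _ (centralHom χ (classSum K)) 1 (by simp)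
    (by rw [centralHom_classSum]; simp)]
  simp [lamHom]

/-- Block induction in terms of the reduced central characters as ring homomorphisms. -/
theorem isInducedBlock_iff {H G : Type*} [Group H] [Group G] [Finite G] [Finite H] (f : H →* G)
    (hf : Function.Injective f) (φ : Irr H) (χ : Irr G) :
    IsInducedBlock f (bl red φ) (bl red χ) ↔
      ∀ z, lamHom red χ z = lamHom red φ (ClassRing.res f hf z) := by
  have hK : ∀ K : ConjClasses G, lamHom red φ (ClassRing.res f hf (classSum K)) =
      ∑ᶠ L : {L : ConjClasses H // ConjClasses.map f L = K}, (bl red φ).lam L.1 := by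
    intro K
    classical
    have := Fintype.ofFinite (ConjClasses H)
    rw [res_classSum, map_sum, finsum_eq_sum_of_fintype]
    exact sum_congr rfl fun L _ => lamHom_classSum red φ L.1
  constructor
  · intro h z
    have : (lamHom red χ : ClassRing G →+ AlgebraicClosure (ZMod ℓ)) =
        (lamHom red φ : ClassRing H →+ AlgebraicClosure (ZMod ℓ)).comp (ClassRing.res f hf) :=
      ClassRing.addHom_ext fun K =>
        (lamHom_classSum red χ K).trans ((h K).trans (hK K).symm)
    exact DFunLike.congr_fun this z
  · intro h K
    rw [← hK, ← h, lamHom_classSum]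
    rfl

/-! ### Nilpotent class functions and the Brauer homomorphism -/

/-- A class function that vanishes on the centralizer of a normal `ℓ`-subgroup is a nilpotent
element of the group algebra in characteristic `ℓ`. -/
theorem isNilpotent_of_coeff_eq_zero {N : Type*} [Group N] [Finite N] (P : Subgroup N) [P.Normal]
    (hP : IsPGroup ℓ P) (z : MonoidAlgebra (ZMod ℓ) N)
    (hz : z ∈ Subring.center (MonoidAlgebra (ZMod ℓ) N))
    (hz0 : ∀ x, (∀ q ∈ P, q * x * q⁻¹ = x) → z.coeff x = 0) : IsNilpotent z := by
  classical
  have := Fintype.ofFinite N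
  let R := MonoidAlgebra (ZMod ℓ) N
  have hR : Finite R := Finite.of_injective (fun w : R => (w.coeff : N → ZMod ℓ))
    (DFunLike.coe_injective.comp MonoidAlgebra.coeff_injective)
  -- If `w` is invariant under left multiplication by `P`, then `x ↦ z(x) w(x⁻¹ g)` is invariant
  -- under conjugation by `P`, by normality of `P`. At the fixed points, the centralizer of `P`, it
  -- vanishes with `z`.
  have hfix : ∀ w : R, (∀ q ∈ P, MonoidAlgebra.of (ZMod ℓ) N q * w = w) → z * w = 0 := by
    intro w hw
    have hw' : ∀ q ∈ P, ∀ g, w.coeff (q * g) = w.coeff g := by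
      intro q hq g
      have := congrArg (fun v => MonoidAlgebra.coeff v g) (hw q⁻¹ (P.inv_mem hq))
      have h2 := MonoidAlgebra.coeff_single_mul_apply w (1 : ZMod ℓ) q⁻¹ g
      rw [inv_inv, one_mul] at h2
      exact h2.symm.trans this
    ext g
    rw [coeff_mul_eq_sum]
    let _ : MulAction P N :=
      MulAction.compHom N ((MulAut.conj : N →* MulAut N).comp P.subtype)
    have hsm : ∀ (q : P) (x : N), q • x = q.1 * x * q.1⁻¹ := fun _ _ => rfl
    refine sum_eq_zero_of_isPGroup hP _ (fun q x => ?_) (fun x hx => ?_)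
    · rw [hsm, (mem_center_iff_coeff z).mp hz]
      congr 1
      have h1 : (q.1 * x * q.1⁻¹)⁻¹ * g = q.1 * ((x⁻¹ * q.1⁻¹ * x) * (x⁻¹ * g)) := by group
      rw [h1, hw' _ q.2, hw']
      simpa using Subgroup.Normal.conj_mem ‹P.Normal› _ (P.inv_mem q.2) x⁻¹
    · rw [hz0 x fun q hq => hx ⟨q, hq⟩, zero_mul]
  by_contra hnil
  -- The powers of `z` repeat in the finite ring `R`. If none is zero, the elements fixed by `z ^ (p
  -- + 1)` form a nonzero `𝔽_ℓ`-space `W` on which `P` acts, so `P` fixes some nonzero `b` in `W`.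
  -- But `hfix` gives `z * b = 0`, contrary to `z ^ (p + 1) * b = b`.
  obtain ⟨i, j, hij, hpow⟩ : ∃ i j : ℕ, i < j ∧ z ^ i = z ^ j := by
    obtain ⟨i, j, hne, h⟩ := Finite.exists_ne_map_eq_of_infinite (fun n : ℕ => z ^ n)
    rcases lt_or_gt_of_ne hne with hlt | hlt
    · exact ⟨i, j, hlt, h⟩
    · exact ⟨j, i, hlt, h.symm⟩
  obtain ⟨p, rfl⟩ := Nat.exists_eq_add_of_lt hij
  let W := {w : R // z ^ (p + 1) * w = w}
  let _ : MulAction P W :=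
    { smul := fun q w => ⟨MonoidAlgebra.of (ZMod ℓ) N q.1 * w.1, by
        rw [← mul_assoc, ← Subring.mem_center_iff.mp (Subring.pow_mem _ hz _), mul_assoc, w.2]⟩
      one_smul := fun w => Subtype.ext (by
        change MonoidAlgebra.of (ZMod ℓ) N 1 * w.1 = w.1
        rw [map_one, one_mul])
      mul_smul := fun a b w => Subtype.ext (by
        change MonoidAlgebra.of (ZMod ℓ) N (a.1 * b.1) * w.1 = _ * (_ * _)
        rw [map_mul, mul_assoc]) }
  let w₀ : W := ⟨0, mul_zero _⟩
  let w₁ : W := ⟨z ^ i, by rw [← pow_add, hpow]; congr 1; omega⟩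
  have hne : w₁ ≠ w₀ := fun h => hnil ⟨i, congrArg Subtype.val h⟩
  let A : AddSubgroup R := (AddMonoidHom.mulLeft (z ^ (p + 1)) - AddMonoidHom.id R).ker
  have hA : Nat.card A = Nat.card W := Nat.card_congr
    { toFun := fun a => ⟨a.1, sub_eq_zero.mp a.2⟩
      invFun := fun a => ⟨a.1, sub_eq_zero.mpr a.2⟩ }
  have hdvd : ℓ ∣ Nat.card W := by
    rw [← hA]
    let a : A := ⟨z ^ i, sub_eq_zero.mpr w₁.2⟩
    have ha : addOrderOf a = ℓ := by
      refine addOrderOf_eq_prime ?_ fun h => hnil ⟨i, congrArg Subtype.val h⟩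
      refine Subtype.ext ?_
      change ℓ • z ^ i = 0
      ext g
      change ℓ • (z ^ i).coeff g = 0
      rw [nsmul_eq_mul, CharP.cast_eq_zero, zero_mul]
    exact (dvd_of_eq ha.symm).trans (addOrderOf_dvd_natCard a)
  obtain ⟨b, hb, hb0⟩ := hP.exists_fixed_point_of_prime_dvd_card_of_fixed_point W hdvd
    (a := w₀) (fun q => Subtype.ext (mul_zero _))
  apply hb0
  refine Subtype.ext ?_
  have h1 := hfix b.1 fun q hq => congrArg Subtype.val (hb ⟨q, hq⟩)
  have h2 : ∀ c : R, z * c = 0 → z ^ (p + 1) * c = 0 := fun c hc => by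
    rw [pow_succ, mul_assoc, hc, mul_zero]
  exact (h2 b.1 h1).symm.trans b.2

/-- Reduced central characters vanish on class functions whose values on the centralizer of a
normal `ℓ`-subgroup are divisible by `ℓ`. -/
theorem lamHom_eq_zero {N : Type*} [Group N] [Finite N] (P : Subgroup N) [P.Normal]
    (hP : IsPGroup ℓ P) (φ : Irr N) (z : ClassRing N)
    (hz : ∀ x, (∀ q ∈ P, q * x * q⁻¹ = x) → ((z.1.coeff x : ℤ) : ZMod ℓ) = 0) :
    lamHom red φ z = 0 := by
  let m := MonoidAlgebra.mapRingHom N (Int.castRingHom (ZMod ℓ))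
  have hm : ∀ w g, (m w).coeff g = ((w.coeff g : ℤ) : ZMod ℓ) := fun w g => by simp [m]
  obtain ⟨k, hk⟩ := isNilpotent_of_coeff_eq_zero P hP (m z.1)
    ((mem_center_iff_coeff _).mpr fun g h => by rw [hm, hm, ClassRing.coeff_conj])
    (fun x hx => by rw [hm, hz x hx])
  have hdvd : ∀ g, (ℓ : ℤ) ∣ (z ^ k).1.coeff g := by
    intro g
    rw [← ZMod.intCast_zmod_eq_zero_iff_dvd, ← hm]
    change (m (z.1 ^ k)).coeff g = 0
    rw [map_pow, hk]
    rfl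
  -- Nilpotency modulo `ℓ` makes `z ^ k` equal to `ℓ` times a central element `e`, so its image in
  -- characteristic `ℓ` is zero.
  let e : ClassRing N := ⟨MonoidAlgebra.ofCoeff
    ((z ^ k).1.coeff.mapRange (fun a => a / (ℓ : ℤ)) (by simp)), by
      rw [mem_center_iff_coeff]
      intro g h
      simp only [Finsupp.mapRange_apply]
      rw [ClassRing.coeff_conj]⟩
  have he : z ^ k = ℓ • e := by
    apply ClassRing.ext_coeff
    intro g
    change _ = ClassRing.coeffHom g (ℓ • e)
    rw [map_nsmul, nsmul_eq_mul]
    exact (Int.mul_ediv_cancel' (hdvd g)).symm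
  have h1 := congrArg (lamHom red φ) he
  rw [map_pow, map_nsmul, nsmul_eq_mul, CharP.cast_eq_zero, zero_mul] at h1
  exact eq_zero_of_pow_eq_zero h1

/-- If a subgroup `N` has a normal `ℓ`-subgroup whose centralizer in `H` lies in `N`, then the
composition of the restriction to `N` with a reduced central character of `N` is
multiplicative. -/
theorem lamHom_res_mul {N H : Type*} [Group N] [Finite N] [Group H] [Finite H] (f : N →* H)
    (hf : Function.Injective f) (P : Subgroup N) [P.Normal] (hP : IsPGroup ℓ P)
    (hcent : ∀ x, (∀ q ∈ P, f q * x * (f q)⁻¹ = x) → x ∈ f.range) (φ : Irr N)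
    (z w : ClassRing H) :
    lamHom red φ (ClassRing.res f hf (z * w)) =
      lamHom red φ (ClassRing.res f hf z) * lamHom red φ (ClassRing.res f hf w) := by
  classical
  have := Fintype.ofFinite N
  have := Fintype.ofFinite H
  rw [← map_mul, ← sub_eq_zero, ← map_sub]
  refine lamHom_eq_zero red P hP φ _ fun c hc => ?_
  -- The defect of multiplicativity is the part of the convolution over elements outside `N`. When
  -- `c` centralizes `P`, conjugation by `P` preserves its terms, and `hcent` leaves no fixed points
  -- outside `N`.
  have h1 : (ClassRing.res f hf (z * w) - ClassRing.res f hf z * ClassRing.res f hf w).1.coeff c =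
      ∑ h, if h ∈ f.range then 0 else z.1.coeff h * w.1.coeff (h⁻¹ * f c) := by
    change (z.1 * w.1).coeff (f c) -
      ((ClassRing.res f hf z).1 * (ClassRing.res f hf w).1).coeff c = _
    rw [coeff_mul_eq_sum, coeff_mul_eq_sum, sub_eq_iff_eq_add]
    simp only [ClassRing.coeff_res, map_mul, map_inv]
    have h2 : univ.image f = univ.filter fun h => h ∈ f.range := by
      ext h
      simp
    rw [← sum_image (s := univ) (g := f)
      (f := fun h => z.1.coeff h * w.1.coeff (h⁻¹ * f c)) (fun a _ b _ hab => hf hab),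
      h2, sum_filter, ← sum_add_distrib]
    refine sum_congr rfl fun h _ => ?_
    split_ifs <;> simp
  rw [h1, Int.cast_sum]
  let _ : MulAction P H :=
    MulAction.compHom H ((MulAut.conj : H →* MulAut H).comp (f.comp P.subtype))
  have hsm : ∀ (q : P) (x : H), q • x = f q.1 * x * (f q.1)⁻¹ := fun _ _ => rfl
  refine sum_eq_zero_of_isPGroup hP _ (fun q x => ?_) (fun x hx => ?_)
  · have hmem : q • x ∈ f.range ↔ x ∈ f.range := by
      have hq : f q.1 ∈ f.range := ⟨_, rfl⟩
      rw [hsm, Subgroup.mul_mem_cancel_right _ (f.range.inv_mem hq),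
        Subgroup.mul_mem_cancel_left _ hq]
    have h2 : (q • x)⁻¹ * f c = f q.1 * (x⁻¹ * f c) * (f q.1)⁻¹ := by
      conv_lhs => rw [← hc q.1 q.2]
      simp only [hsm, map_mul, map_inv]
      group
    simp only [hmem, h2]
    rw [ClassRing.coeff_conj, hsm, ClassRing.coeff_conj]
  · rw [if_pos (hcent x fun q hq => hx ⟨q, hq⟩), Int.cast_zero]

/-! ### Block induction and extensions of characters -/

/-- On class functions supported in a subgroup, the central character of an extension is that of
the extended character. -/
theorem lamHom_eq_of_support {G H : Type*} [Group G] [Finite G] [Group H] [Finite H] (i : G →* H)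
    (hi : Function.Injective i) (χ : Irr G) (χ' : Irr H) (hχ : ∀ g, χ' (i g) = χ g)
    (z : ClassRing H) (hz : ∀ h, z.1.coeff h ≠ 0 → h ∈ i.range) :
    lamHom red χ' z = lamHom red χ (ClassRing.res i hi z) := by
  classical
  have := Fintype.ofFinite G
  have := Fintype.ofFinite H
  refine congrArg red (Subtype.ext ?_)
  rw [centralHom_apply, centralHom_apply, ← hχ 1, map_one]
  congr 1
  simp only [ClassRing.coeff_res, ← hχ]
  rw [← sum_image (s := univ) (g := i) (f := fun h => ((z.1.coeff h : ℤ) : ℂ) * χ' h)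
    (fun a _ b _ hab => hi hab)]
  symm
  refine sum_subset (subset_univ _) fun h _ hh => ?_
  have : z.1.coeff h = 0 := by
    by_contra hne
    obtain ⟨g, rfl⟩ := hz h hne
    exact hh (mem_image_of_mem _ (mem_univ g))
  rw [this, Int.cast_zero, zero_mul]

/-- The central character of the product with a linear character, on a class function supported
where the linear character is constant. -/
theorem lamHom_mul_linear {N : Type*} [Group N] [Finite N] (φ φ' : Irr N) (b : N → ℂ)
    (hφ : ∀ x, φ' x = φ x * b x) (hb : b 1 = 1) (ζ : integralClosure ℤ ℂ) (z : ClassRing N)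
    (hz : ∀ x, z.1.coeff x ≠ 0 → b x = ζ) : lamHom red φ' z = red ζ * lamHom red φ z := by
  have := Fintype.ofFinite N
  change red _ = red ζ * red _
  rw [← map_mul]
  refine congrArg red (Subtype.ext ?_)
  push_cast
  rw [centralHom_apply, centralHom_apply, hφ 1, hb, mul_one, ← mul_div_assoc, mul_sum]
  congr 1
  refine sum_congr rfl fun x _ => ?_
  by_cases hx : z.1.coeff x = 0
  · simp [hx]
  · rw [hφ, hz x hx]
    ring

/-- Let `H / G` be cyclic, let `N'` be a subgroup of `H` that contains the centralizer of a normal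
`ℓ`-subgroup of `N'`, and let `N = N' ∩ G`. If the block of `φ ∈ Irr(N)` induces to that of
`χ ∈ Irr(G)` and both characters extend, then the extension of `φ` can be multiplied by a linear
character of `H / G` so that its block induces to that of the extension of `χ`. -/
theorem exists_linear_isInducedBlock {N G N' H C : Type*} [Group N] [Finite N] [Group G] [Finite G]
    [Group N'] [Finite N'] [Group H] [Finite H] [Group C] [Finite C] [IsCyclic C]
    (j : N →* G) (hj : Function.Injective j) (i : G →* H) (hi : Function.Injective i)
    (j' : N' →* H) (hj' : Function.Injective j') (i' : N →* N') (hi' : Function.Injective i')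
    (hsq : ∀ n, i (j n) = j' (i' n)) (hpull : ∀ x, j' x ∈ i.range → x ∈ i'.range)
    (p : H →* C) (hp : p.ker = i.range) (P : Subgroup N') [P.Normal] (hP : IsPGroup ℓ P)
    (hcent : ∀ x, (∀ q ∈ P, j' q * x * (j' q)⁻¹ = x) → x ∈ j'.range)
    (χ : Irr G) (φ : Irr N) (χ' : Irr H) (φ' : Irr N') (hχ : ∀ g, χ' (i g) = χ g)
    (hφ : ∀ n, φ' (i' n) = φ n) (hind : IsInducedBlock j (bl red φ) (bl red χ)) :
    ∃ β : C →* ℂˣ, ∀ φ'' : Irr N', (∀ x, φ'' x = φ' x * (β (p (j' x)) : ℂ)) →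
      IsInducedBlock j' (bl red φ'') (bl red χ') := by
  classical
  have := Fintype.ofFinite H
  obtain ⟨g, hg⟩ := IsCyclic.exists_generator (α := C)
  -- Degree `c` means support in the fibre of `p` over `c`.
  let gr : C → ClassRing H → Prop := fun c z => ∀ h, z.1.coeff h ≠ 0 → p h = c
  have hone : gr 1 1 := by
    intro h hh
    by_cases h1 : h = 1
    · rw [h1, map_one]
    · refine absurd ?_ hh
      change (1 : MonoidAlgebra ℤ H).coeff h = 0
      rw [MonoidAlgebra.one_def, MonoidAlgebra.coeff_single, Finsupp.single_apply,
        if_neg (Ne.symm h1)]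
  have hmul : ∀ a b x y, gr a x → gr b y → gr (a * b) (x * y) := by
    intro a b x y hx hy h hh
    change (x.1 * y.1).coeff h ≠ 0 at hh
    rw [coeff_mul_eq_sum] at hh
    obtain ⟨k, -, hk⟩ := exists_ne_zero_of_sum_ne_zero hh
    have h1 := hx k (left_ne_zero_of_mul hk)
    have h2 := hy _ (right_ne_zero_of_mul hk)
    rw [← h1, ← h2, ← map_mul, mul_inv_cancel_left]
  let f' : ClassRing H →+* AlgebraicClosure (ZMod ℓ) :=
    { (lamHom red φ' : ClassRing N' →+ AlgebraicClosure (ZMod ℓ)).comp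
        (ClassRing.res j' hj') with
      map_one' := by
        change lamHom red φ' (ClassRing.res j' hj' 1) = 1
        have : ClassRing.res j' hj' 1 = 1 := by
          apply ClassRing.ext_coeff
          intro n
          change (1 : MonoidAlgebra ℤ H).coeff (j' n) = (1 : MonoidAlgebra ℤ N').coeff n
          rw [MonoidAlgebra.one_def, MonoidAlgebra.one_def, MonoidAlgebra.coeff_single,
            MonoidAlgebra.coeff_single, Finsupp.single_apply, Finsupp.single_apply]
          refine if_congr ?_ rfl rfl
          rw [← map_one j', hj'.eq_iff]
        rw [this, map_one]
      map_mul' := lamHom_res_mul red j' hj' P hP hcent φ' }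
  have hf' : ∀ z, f' z = lamHom red φ' (ClassRing.res j' hj' z) := fun _ => rfl
  -- Degree `1` means support in `G`. By `hpull` the restriction to `N'` is then supported in `N`,
  -- and `hind` applies.
  have hagree : ∀ z, gr 1 z → lamHom red χ' z = f' z := by
    intro z hz
    have hz' : ∀ h, z.1.coeff h ≠ 0 → h ∈ i.range := by
      intro h hh
      rw [← hp]
      exact hz h hh
    rw [hf', lamHom_eq_of_support red i hi χ χ' hχ z hz',
      (isInducedBlock_iff red j hj φ χ).mp hind,
      lamHom_eq_of_support red i' hi' φ φ' hφ _ fun n hn => hpull n (hz' _ hn)]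
    congr 1
    apply ClassRing.ext_coeff
    intro n
    simp only [ClassRing.coeff_res, hsq]
  obtain ⟨u, hu, hcomp⟩ := exists_pow_mul_eq_of_eqOn_one gr hone hmul (lamHom red χ') f' hagree g
    (orderOf_pos g) (pow_orderOf_eq_one g)
  obtain ⟨ζ, hζ, rfl⟩ := exists_pow_eq_one_map_eq red (orderOf_pos g) hu
  have hζ' : (ζ : ℂ) ^ orderOf g = 1 := by
    have := congrArg Subtype.val hζ
    simpa using this
  let v : ℂˣ := Units.ofPowEqOne (ζ : ℂ) (orderOf g) hζ' (orderOf_pos g).ne'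
  have hv : orderOf v ∣ orderOf g := orderOf_dvd_of_pow_eq_one (Units.pow_ofPowEqOne _ _)
  refine ⟨monoidHomOfForallMemZpowers hg hv, fun φ'' hφ'' => ?_⟩
  rw [isInducedBlock_iff red j' hj']
  have hhom : ∀ (k : ℕ) z, gr (g ^ k) z →
      lamHom red χ' z = lamHom red φ'' (ClassRing.res j' hj' z) := by
    intro k z hz
    rw [hcomp k z hz, hf', lamHom_mul_linear red φ' φ''
      (fun x => ((monoidHomOfForallMemZpowers hg hv (p (j' x)) : ℂˣ) : ℂ)) hφ'' (by simp) (ζ ^ k),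
      map_pow]
    intro x hx
    rw [hz (j' x) hx, map_pow, monoidHomOfForallMemZpowers_apply_gen]
    simp [v]
  have hext : (lamHom red χ' : ClassRing H →+ AlgebraicClosure (ZMod ℓ)) =
      (lamHom red φ'' : ClassRing N' →+ AlgebraicClosure (ZMod ℓ)).comp (ClassRing.res j' hj') := by
    -- Class sums suffice, and they are homogeneous because `C` is abelian.
    refine ClassRing.addHom_ext fun K => ?_
    obtain ⟨x, rfl⟩ := K.exists_rep
    have hx := hg (p x)
    rw [mem_zpowers_iff_mem_range_orderOf] at hx
    obtain ⟨k, -, hk⟩ := mem_image.mp hx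
    refine hhom k _ fun h hh => ?_
    change (classSum (ConjClasses.mk x)).1.coeff h ≠ 0 at hh
    rw [coeff_classSum] at hh
    obtain ⟨c, rfl⟩ := isConj_iff.mp
      (ConjClasses.mk_eq_mk_iff_isConj.mp (ite_ne_right_iff.mp hh).1)
    have hcomm := (IsCyclic.commGroup (α := C)).mul_comm (p c) (p h)
    rw [hk, map_mul, map_mul, map_inv, hcomm, mul_inv_cancel_right]
  exact DFunLike.congr_fun hext

/-! ### The group `G ⋊ ⟨η⟩` -/

instance {G : Type*} [Group G] [Finite G] (η : MulAut G) : Finite (CyclicExt η) :=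
  Finite.of_equiv _ SemidirectProduct.equivProd.symm

/-- Conjugation by an element of `G ⋊ ⟨η⟩` on `G` fixes the irreducible characters of `G` that
are invariant under `η`. -/
theorem CyclicExt.exists_conj_eq {G : Type*} [Group G] [Finite G] (η : MulAut G) (χ : Irr G)
    (hη : ∀ g, χ (η g) = χ g) (m : CyclicExt η) :
    ∃ α : MulAut G, (∀ g, CyclicExt.incl η (α g) = m * CyclicExt.incl η g * m⁻¹) ∧
      ∀ g, χ (α g) = χ g := by
  classical
  have hk : ∀ (k : ℕ) g, χ ((η ^ k) g) = χ g := by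
    intro k
    induction k with
    | zero => simp
    | succ k ih =>
      intro g
      rw [pow_succ, MulAut.mul_apply, ih, hη]
  have hpow : ∀ a ∈ Subgroup.zpowers η, ∀ g, χ (a g) = χ g := by
    intro a ha g
    rw [mem_zpowers_iff_mem_range_orderOf] at ha
    obtain ⟨k, -, rfl⟩ := mem_image.mp ha
    exact hk k g
  refine ⟨MulAut.conj m.left * m.right.1, fun g => ?_, fun g => ?_⟩
  · have h1 := SemidirectProduct.inl_aut (φ := (Subgroup.zpowers η).subtype) m.right g
    have h2 := SemidirectProduct.inl_left_mul_inr_right m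
    rw [MulAut.mul_apply, MulAut.conj_apply, map_mul, map_mul, map_inv]
    conv_rhs => rw [← h2]
    change _ * SemidirectProduct.inl ((Subgroup.zpowers η).subtype m.right g) * _ = _
    rw [h1, map_inv]
    simp only [mul_assoc, mul_inv_rev]
  · rw [MulAut.mul_apply, MulAut.conj_apply, Irr.conj_apply, hpow _ m.right.2]

theorem CyclicExt.ker_rightHom {G : Type*} [Group G] (η : MulAut G) :
    (SemidirectProduct.rightHom : CyclicExt η →* Subgroup.zpowers η).ker =
      (CyclicExt.incl η).range :=
  SemidirectProduct.range_inl_eq_ker_rightHom.symm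

theorem CyclicExt.incl_injective {G : Type*} [Group G] (η : MulAut G) :
    Function.Injective (CyclicExt.incl η) :=
  SemidirectProduct.inl_injective

theorem CyclicExt.incl_mem_normalizer_iff {G : Type*} [Group G] (η : MulAut G) (Q : Subgroup G)
    (g : G) : CyclicExt.incl η g ∈ CyclicExt.normalizer η Q ↔
      g ∈ Subgroup.normalizer (Q : Set G) := by
  refine ⟨fun h => ?_, fun h => Subgroup.le_normalizer_map _ ⟨g, h, rfl⟩⟩
  rw [Subgroup.mem_normalizer_iff]
  intro x
  have := Subgroup.mem_normalizer_iff.mp h (CyclicExt.incl η x)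
  rwa [← map_mul, ← map_inv, ← map_mul, Subgroup.mem_map_iff_mem (CyclicExt.incl_injective η),
    Subgroup.mem_map_iff_mem (CyclicExt.incl_injective η)] at this

theorem CyclicExt.normalizerIncl_injective {G : Type*} [Group G] (η : MulAut G)
    (Q : Subgroup G) : Function.Injective (CyclicExt.normalizerIncl η Q) := fun _ _ h =>
  Subtype.ext (CyclicExt.incl_injective η (congrArg Subtype.val h))

/-- An automorphism of `G` induced by an element of `N_A(Q)` stabilizes `Q`. -/
theorem CyclicExt.map_eq_of_mem_normalizer {G : Type*} [Group G] [Finite G] (η : MulAut G)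
    (Q : Subgroup G) (m : CyclicExt η) (hm : m ∈ CyclicExt.normalizer η Q) (α : MulAut G)
    (hα : ∀ g, CyclicExt.incl η (α g) = m * CyclicExt.incl η g * m⁻¹) :
    Q.map α.toMonoidHom = Q := by
  have key : ∀ g, α g ∈ Q ↔ g ∈ Q := by
    intro g
    rw [← Subgroup.mem_map_iff_mem (CyclicExt.incl_injective η) (x := α g), hα,
      ← Subgroup.mem_normalizer_iff.mp hm, Subgroup.mem_map_iff_mem (CyclicExt.incl_injective η)]
  ext g
  constructor
  · rintro ⟨x, hx, rfl⟩
    exact (key x).mpr hx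
  · intro hg
    refine ⟨α.symm g, (key _).mp ?_, α.apply_symm_apply g⟩
    rwa [MulEquiv.apply_symm_apply]

end BlockTheory

end

/-! ### Extensions with compatible blocks -/

theorem lemma5p6 {ℓ : ℕ} [Fact ℓ.Prime]
    (red : integralClosure ℤ ℂ →+* AlgebraicClosure (ZMod ℓ))
    {S G : Type*} [Group S] [Finite S] [IsSimpleGroup S] [Group G] [Finite G]
    (π : G →* S) (hπ : BlockTheory.IsUniversalPrimeToCovering ℓ π)
    (Q : Subgroup G) (hQ : BlockTheory.IsRadicalSubgroup ℓ Q)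
    (Ω : BlockTheory.irrZero red Q ≃
      BlockTheory.irrZero red (Q.subgroupOf (Subgroup.normalizer (Q : Set G))))
    (hΩ : BlockTheory.InductiveAMConditions red Q (Subgroup.normalizer (Q : Set G)) Ω)
    (χ : BlockTheory.irrZero red Q)
    (η : MulAut G) (hη : ∀ g : G, χ.1 (η g) = χ.1 g)
    (ηS : MulAut S) (hηS : ∀ g : G, π (η g) = ηS (π g))
    (hgen : BlockTheory.autStabilizer π χ.1 =
      (MulAut.conj : S →* MulAut S).range ⊔ Subgroup.zpowers ηS)
    (A' : Subgroup (BlockTheory.CyclicExt η)) (hA' : BlockTheory.IsHallPrimeToPart ℓ η A') :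
    ∃ (χt : BlockTheory.Irr (BlockTheory.CyclicExt η))
      (φt : BlockTheory.Irr (BlockTheory.CyclicExt.normalizer η Q)),
      (∀ g : G, χt (BlockTheory.CyclicExt.incl η g) = χ.1 g) ∧
      (∀ g : Subgroup.normalizer (Q : Set G),
        φt (BlockTheory.CyclicExt.normalizerIncl η Q g) = (Ω χ).1 g) ∧
      ∃ (χ' : BlockTheory.Irr A')
        (φ' : BlockTheory.Irr
          (BlockTheory.CyclicExt.normalizer η Q ⊓ A' : Subgroup (BlockTheory.CyclicExt η))),
        (∀ a : A', χ' a = χt a) ∧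
        (∀ a : (BlockTheory.CyclicExt.normalizer η Q ⊓ A' :
            Subgroup (BlockTheory.CyclicExt η)),
          φ' a = φt (Subgroup.inclusion inf_le_left a)) ∧
        BlockTheory.IsInducedBlock
          (Subgroup.inclusion (inf_le_right : BlockTheory.CyclicExt.normalizer η Q ⊓ A' ≤ A'))
          (BlockTheory.bl red φ') (BlockTheory.bl red χ') := by

  classical
  have hinj := BlockTheory.CyclicExt.incl_injective η
  obtain ⟨d, σ, hσ, hσχ⟩ := BlockTheory.exists_extension (BlockTheory.CyclicExt.incl η) hinj
    SemidirectProduct.rightHom (BlockTheory.CyclicExt.ker_rightHom η) χ.1 (fun m n n' h => by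
      obtain ⟨α, hα, hαχ⟩ := BlockTheory.CyclicExt.exists_conj_eq η χ.1 hη m
      rw [← hα] at h
      rw [hinj h, hαχ])
  let M := BlockTheory.CyclicExt.normalizer η Q
  let pM : M →* Subgroup.zpowers η := SemidirectProduct.rightHom.comp M.subtype
  have hright : ∀ g, (SemidirectProduct.rightHom : BlockTheory.CyclicExt η →* _)
      (BlockTheory.CyclicExt.incl η g) = 1 := fun g => SemidirectProduct.rightHom_inl g
  have hpM : pM.ker = (BlockTheory.CyclicExt.normalizerIncl η Q).range := by
    ext x
    constructor
    · intro hx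
      have hx' : (x : BlockTheory.CyclicExt η) ∈ (BlockTheory.CyclicExt.incl η).range := by
        rw [← BlockTheory.CyclicExt.ker_rightHom]
        exact hx
      obtain ⟨g, hg⟩ := hx'
      have hgx : BlockTheory.CyclicExt.incl η g ∈ M := hg ▸ x.2
      exact ⟨⟨g, (BlockTheory.CyclicExt.incl_mem_normalizer_iff η Q g).mp hgx⟩, Subtype.ext hg⟩
    · rintro ⟨g, rfl⟩
      exact hright g
  obtain ⟨e, τ, hτ, hτφ⟩ := BlockTheory.exists_extension (BlockTheory.CyclicExt.normalizerIncl η Q)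
    (BlockTheory.CyclicExt.normalizerIncl_injective η Q) pM hpM (Ω χ).1 (fun m n n' h => by
      obtain ⟨α, hα, hαχ⟩ := BlockTheory.CyclicExt.exists_conj_eq η χ.1 hη m
      have hn : (n' : G) = α n := hinj (by rw [hα]; exact congrArg Subtype.val h)
      have hαn : α n ∈ Subgroup.normalizer (Q : Set G) := hn ▸ n'.2
      -- Because `α` fixes `χ`, equivariance with both characters equal to `χ` says that `α` fixes
      -- `Ω χ`.
      have := hΩ.equivariant α (BlockTheory.CyclicExt.map_eq_of_mem_normalizer η Q m m.2 α hα)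
        χ χ hαχ n n.2 hαn
      exact (congrArg (Ω χ).1.1 (Subtype.ext hn)).trans this)
  let N' := BlockTheory.CyclicExt.normalizer η Q ⊓ A'
  let i : G →* A' := (BlockTheory.CyclicExt.incl η).codRestrict A' fun g => hA'.1 ⟨g, rfl⟩
  let j' : N' →* A' := Subgroup.inclusion inf_le_right
  let i' : Subgroup.normalizer (Q : Set G) →* N' :=
    ((BlockTheory.CyclicExt.incl η).comp (Subgroup.subtype _)).codRestrict N' fun g =>
      ⟨(BlockTheory.CyclicExt.incl_mem_normalizer_iff η Q g).mpr g.2, hA'.1 ⟨g, rfl⟩⟩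
  have hi : Function.Injective i := fun a b h => hinj (congrArg Subtype.val h)
  have hi' : Function.Injective i' := fun a b h =>
    Subtype.ext (hinj (congrArg Subtype.val h))
  have hσi : Representation.IsIrreducible (σ.comp A'.subtype : Representation ℂ A' _) :=
    BlockTheory.isIrreducible_of_comp i _ hσ
  have hτi : Representation.IsIrreducible (τ.comp (Subgroup.inclusion inf_le_left : N' →* M) :
      Representation ℂ N' _) := BlockTheory.isIrreducible_of_comp i' _ hτ
  let χt : BlockTheory.Irr (BlockTheory.CyclicExt η) :=
    ⟨σ.character, d, σ, BlockTheory.isIrreducible_of_comp _ _ hσ, rfl⟩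
  let χ' : BlockTheory.Irr A' := ⟨fun a => σ.character a, d, _, hσi, rfl⟩
  let φ' : BlockTheory.Irr N' :=
    ⟨fun a => τ.character (Subgroup.inclusion inf_le_left a), e, _, hτi, rfl⟩
  have hQM : Q.map (BlockTheory.CyclicExt.incl η) ≤ N' :=
    le_inf Subgroup.le_normalizer (Subgroup.map_le_range _ _ |>.trans hA'.1)
  let P : Subgroup N' := (Q.map (BlockTheory.CyclicExt.incl η)).subgroupOf N'
  have hPn : P.Normal := by
    refine ⟨fun q hq x => ?_⟩
    exact (Subgroup.mem_normalizer_iff.mp x.2.1 _).mp hq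
  have hP : IsPGroup ℓ P := by
    refine (hQ.1.map (BlockTheory.CyclicExt.incl η)).of_equiv
      (Subgroup.subgroupOfEquivOfLe hQM).symm
  obtain ⟨β, hβ⟩ := BlockTheory.exists_linear_isInducedBlock red
    (Subgroup.normalizer (Q : Set G)).subtype Subtype.val_injective i hi j'
    (Subgroup.inclusion_injective _) i' hi' (fun n => rfl)
    (by
      rintro x ⟨g, hg⟩
      have hg' : BlockTheory.CyclicExt.incl η g = x := congrArg Subtype.val hg
      have hgM : BlockTheory.CyclicExt.incl η g ∈ M := hg' ▸ x.2.1
      exact ⟨⟨g, (BlockTheory.CyclicExt.incl_mem_normalizer_iff η Q g).mp hgM⟩, Subtype.ext hg'⟩)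
    (SemidirectProduct.rightHom.comp A'.subtype)
    (by
      ext x
      rw [MonoidHom.mem_ker]
      change (x : BlockTheory.CyclicExt η) ∈ SemidirectProduct.rightHom.ker ↔ _
      rw [BlockTheory.CyclicExt.ker_rightHom]
      exact ⟨fun ⟨g, hg⟩ => ⟨g, Subtype.ext hg⟩, fun ⟨g, hg⟩ => ⟨g, congrArg Subtype.val hg⟩⟩)
    P hP
    -- An element of `A'` that centralizes `Q` normalizes it, so it lies in `N'`.
    (by
      intro x hx
      have hxc : ∀ q ∈ Q.map (BlockTheory.CyclicExt.incl η),
          q * (x : BlockTheory.CyclicExt η) * q⁻¹ = x := fun q hq =>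
        congrArg Subtype.val (hx ⟨q, hQM hq⟩ hq)
      have hxM : (x : BlockTheory.CyclicExt η) ∈ M := by
        have hcen : (x : BlockTheory.CyclicExt η) ∈ Subgroup.centralizer
            (Q.map (BlockTheory.CyclicExt.incl η) : Set (BlockTheory.CyclicExt η)) := by
          rw [Subgroup.mem_centralizer_iff]
          intro q hq
          exact mul_inv_eq_iff_eq_mul.mp (hxc q hq)
        exact Subgroup.centralizer_le_normalizer _ hcen
      exact ⟨⟨x, hxM, x.2⟩, rfl⟩)
    χ.1 (Ω χ).1 χ' φ' hσχ hτφ (hΩ.block_induced χ)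
  refine ⟨χt, ⟨_, BlockTheory.isIrredChar_mul_linear
    ⟨e, τ, BlockTheory.isIrreducible_of_comp _ _ hτ, rfl⟩ (β.comp pM)⟩, hσχ, fun g => ?_, χ',
    ⟨_, BlockTheory.isIrredChar_mul_linear φ'.2
      ((β.comp pM).comp (Subgroup.inclusion inf_le_left))⟩, fun a => rfl, fun a => rfl,
    hβ _ fun x => rfl⟩
  change τ.character _ * (β (SemidirectProduct.rightHom (BlockTheory.CyclicExt.incl η g)) : ℂ) = _
  rw [hright, map_one, Units.val_one, mul_one, hτφ]
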